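/- For $x\in\mathbb{R}^n$ and $p>2$ let $F_p(x)=\sum_{i=1}^n|x_i|^p$. A (randomized) linear sketch with $r$ rows consists of a random matrix $S\in\mathbb{R}^{r\times n}$ and a random (jointly measurable) estimator $g:\mathbb{R}^r\to\mathbb{R}$, defined on one probability space; $g$ may depend on $S$ and on further randomness, and the output on input $x$ is $g(Sx)$. The sketch $(\varepsilon,\delta)$-approximates $F_p$ if for every fixed $x\in\mathbb{R}^n$, $$\Pr\bigl[\,|g(Sx)-F_p(x)|\le\varepsilon F_p(x)\,\bigr]\ge 1-\delta .$$ For every real $p>2$ there is a constant $c''>0$, depending only on $p$, such that for all $\varepsilon_0\in(0,1)$ and $\delta_0\in(0,1/2)$ there is a constant $\kappa>0$, depending only on $p,\varepsilon_0,\delta_0$, with the following property. For all integers $n,r\ge 0$, all $0<\varepsilon\le\varepsilon_0$ and all $\delta$ with $2^{-n^{c''}}\le\delta\le\delta_0$, every linear sketch with $r$ rows that $(\varepsilon,\delta)$-approximates $F_p$ on $\mathbb{R}^n$ satisfies $$r\;\ge\;\kappa\cdot\min\Bigl\{\,n,\;\; n^{1-2/p}\,\varepsilon^{-2/p}\,\log^{2/p}(1/\delta)\,\log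 n\Bigr\}.$$ In particular, whenever the second term is at most $n$, at least $\Omega\bigl(n^{1-2/p}\varepsilon^{-2/p}\log^{2/p}(1/\delta)\log n\bigr)$ rows are needed. -/

import Mathlib

open MeasureTheory

/-- The `p`-th frequency moment `F_p(x) = ∑ i, |x i| ^ p` of a vector `x ∈ ℝⁿ`. -/
noncomputable def freqMoment (p : ℝ) {n : ℕ} (x : Fin n → ℝ) : ℝ :=
  ∑ i, |x i| ^ p

/-- A randomized linear sketch of vectors in `ℝⁿ` with `r` rows. The sample point `ω : Ω` stands for
all the randomness of the algorithm: it determines the sketching matrix `mat ω`, and the output on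
input `x` is `est ω (mat ω *ᵥ x)`. So the estimator sees `x` only through the sketch, but may use
the matrix and further random bits. The estimator is otherwise arbitrary, up to
measurability. -/
structure LinearSketch (Ω : Type*) [MeasurableSpace Ω] (r n : ℕ) where
  /-- the random sketching matrix -/
  mat : Ω → Matrix (Fin r) (Fin n) ℝ
  /-- the random estimator, applied to the sketch -/
  est : Ω → (Fin r → ℝ) → ℝ
  measurable_mat : ∀ i j, Measurable fun ω => mat ω i j
  measurable_est : Measurable fun q : Ω × (Fin r → ℝ) => est q.1 q.2

/-- The output of the sketching algorithm on input `x` with randomness `ω`. -/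
def LinearSketch.output {Ω : Type*} [MeasurableSpace Ω] {r n : ℕ} (A : LinearSketch Ω r n)
    (x : Fin n → ℝ) (ω : Ω) : ℝ :=
  A.est ω ((A.mat ω).mulVec x)

/-- `A` is an `(ε, δ)`-approximation of `F_p`: on every fixed input vector `x`, the output is within
`ε * F_p(x)` of `F_p(x)` with probability at least `1 - δ`. -/
def LinearSketch.Approximates {Ω : Type*} [MeasurableSpace Ω] {r n : ℕ} (A : LinearSketch Ω r n)
    (μ : Measure Ω) (p ε δ : ℝ) : Prop :=
  ∀ x : Fin n → ℝ,
    1 - δ ≤ μ.real {ω | |A.output x ω - freqMoment p x| ≤ ε * freqMoment p x}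

open ProbabilityTheory Matrix
open scoped ENNReal

/-! A sketch must distinguish Gaussian noise in `ℝⁿ` from the same noise shifted by a random vector
that raises `F_p` by a factor `1 + O(ε)`. Averaging fixes one outcome of the randomness, hence one
matrix `S`. The output sees a shift `θ` only through its projection `P θ` onto the row space of `S`,
where `tr P ≤ r`. If two independent shifts are nearly uncorrelated after projection, the likelihood
ratio has small second moment and no test works (`sum_measure_add_shift_le`,
`LinearSketch.one_le_of_shifted_gaussian`). The resulting bound has the form `√(γ(D) χ²)` with
`γ(D)` of order `δ`, so `χ²` may grow like a small power of `1/δ`.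

Main regime, `ε` above `n ^ (-1/2 + 1/(4p))`: the shift is a sum of `T ≈ log (1/δ)` spikes at random
positions, of height `a ≈ (ε n / T) ^ (1/p)`. Most diagonal entries of `P` are at most of order `r /
n`, and the rows through them are short, so a typical off-diagonal entry has order `√r / n`.
Correlations `exp (a² |P u v|)` stay close to `1` on average as long as `a² r / n` is below a small
multiple of `log n`. This threshold is the claimed bound, logarithm included
(`exists_spike_positions`, `correlation_pow_le`, `exists_sparse_rows_lower_bound`).

Small `ε`: the shift is a random sign vector of height `b ≈ √ε`. Convexity gives `F_p` a gain of
order `n b²`, while the correlation cost is `exp (O(b⁴ r))`, so `r` is at least of order `ε⁻²`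
(`exists_sq_mul_rows_lower_bound`). In this range that dominates the claimed minimum. -/

/-! ### Reduction of a sketching matrix to an orthogonal projection -/

/-- Every real matrix with `r` rows factors through an orthogonal projection of trace at most `r`. -/
lemma exists_projection_of_matrix {r n : ℕ} (S : Matrix (Fin r) (Fin n) ℝ) :
    ∃ P : Matrix (Fin n) (Fin n) ℝ, Pᵀ = P ∧ P * P = P ∧ P.trace ≤ r ∧ S * P = S := by
  classical
  let L : EuclideanSpace ℝ (Fin n) →ₗ[ℝ] EuclideanSpace ℝ (Fin r) := S.toEuclideanLin
  let K : Submodule ℝ (EuclideanSpace ℝ (Fin n)) := L.kerᗮ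
  let f : EuclideanSpace ℝ (Fin n) →ₗ[ℝ] EuclideanSpace ℝ (Fin n) :=
    (K.starProjection : EuclideanSpace ℝ (Fin n) →L[ℝ] EuclideanSpace ℝ (Fin n))
  let b := EuclideanSpace.basisFun (Fin n) ℝ
  have hff : f ∘ₗ f = f := by
    ext1 x
    exact K.starProjection_eq_self_iff.2 (K.starProjection_apply_mem x)
  have hsym : f.IsSymmetric := by
    intro x y
    exact K.inner_starProjection_left_eq_right x y
  have hLf : L ∘ₗ f = L := by
    ext1 x
    have h : x - f x ∈ L.ker := by
      have := K.sub_starProjection_mem_orthogonal x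
      rwa [Submodule.orthogonal_orthogonal] at this
    rw [LinearMap.mem_ker, map_sub, sub_eq_zero] at h
    exact h.symm
  have htr : LinearMap.trace ℝ _ f = Module.finrank ℝ K := by
    exact LinearMap.IsProj.trace ⟨K.starProjection_apply_mem,
      fun x hx => K.starProjection_eq_self_iff.2 hx⟩
  have hrank : Module.finrank ℝ K ≤ r := by
    have h1 := L.finrank_range_add_finrank_ker
    have h2 := Submodule.finrank_add_finrank_orthogonal L.ker
    have h3 := L.range.finrank_le
    simp only [finrank_euclideanSpace, Fintype.card_fin] at h1 h2 h3
    change Module.finrank ℝ (L.kerᗮ : Submodule ℝ _) ≤ r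
    omega
  refine ⟨LinearMap.toMatrix b.toBasis b.toBasis f, ?_, ?_, ?_, ?_⟩
  · ext i j
    have h := hsym (b i) (b j)
    rw [real_inner_comm] at h
    simpa [LinearMap.toMatrix_apply, b, EuclideanSpace.inner_single_left] using h
  · rw [← LinearMap.toMatrix_comp, hff]
  · rw [← LinearMap.trace_eq_matrix_trace, htr]
    exact_mod_cast hrank
  · have h := congrArg (LinearMap.toMatrix b.toBasis (EuclideanSpace.basisFun (Fin r) ℝ).toBasis) hLf
    have hS : LinearMap.toMatrix b.toBasis (EuclideanSpace.basisFun (Fin r) ℝ).toBasis L = S := by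
      ext i j
      simp [LinearMap.toMatrix_apply, b, L]
    rw [LinearMap.toMatrix_comp _ b.toBasis, hS] at h
    exact h

/-! ### Gaussian shifts and the second moment of the likelihood ratio -/

/-- The standard Gaussian measure on `ℝⁿ`. -/
noncomputable def stdGaussianPi (n : ℕ) : Measure (Fin n → ℝ) :=
  Measure.pi fun _ => gaussianReal 0 1

instance (n : ℕ) : IsProbabilityMeasure (stdGaussianPi n) := by
  unfold stdGaussianPi; infer_instance

lemma gaussianReal_map_add_eq_withDensity (v : ℝ) :
    (gaussianReal 0 1).map (· + v) =
      (gaussianReal 0 1).withDensity fun x => ENNReal.ofReal (Real.exp (x * v - v ^ 2 / 2)) := by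
  rw [gaussianReal_map_add_const, gaussianReal_of_var_ne_zero _ one_ne_zero,
    gaussianReal_of_var_ne_zero _ one_ne_zero, ← withDensity_mul]
  · congr 1
    ext x
    simp only [gaussianPDF, Pi.mul_apply]
    rw [← ENNReal.ofReal_mul (gaussianPDFReal_nonneg _ _ _), gaussianPDFReal, gaussianPDFReal,
      mul_assoc (√_)⁻¹, ← Real.exp_add]
    congr 3
    simp
    ring
  · exact measurable_gaussianPDF _ _
  · fun_prop

/-- Cameron–Martin formula, obtained coordinatewise because both sides are product measures. -/
lemma stdGaussianPi_map_add_eq_withDensity {n : ℕ} (v : Fin n → ℝ) :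
    (stdGaussianPi n).map (· + v) = (stdGaussianPi n).withDensity
      fun x => ENNReal.ofReal (Real.exp (x ⬝ᵥ v - v ⬝ᵥ v / 2)) := by
  have hσ : ∀ i, SigmaFinite ((gaussianReal 0 1).map (· + v i)) := fun i => by
    rw [gaussianReal_map_add_const]; infer_instance
  have h : (stdGaussianPi n).map (· + v) =
      Measure.pi fun i => (gaussianReal 0 1).map (· + v i) := by
    rw [stdGaussianPi]
    have := Measure.pi_map_pi (μ := fun _ : Fin n => gaussianReal 0 1)
      (f := fun i x => x + v i) (fun i => by fun_prop)
    exact this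
  rw [h]
  refine Measure.pi_eq fun s hs => ?_
  rw [withDensity_apply _ (MeasurableSet.univ_pi hs), stdGaussianPi, Measure.restrict_pi_pi]
  have hint : ∀ i, Integrable (fun x => Real.exp (x * v i - v i ^ 2 / 2))
      ((gaussianReal 0 1).restrict (s i)) := fun i => by
    have := (integrable_exp_mul_gaussianReal (μ := 0) (v := 1) (v i)).mul_const
      (Real.exp (-(v i ^ 2 / 2)))
    refine Integrable.restrict (this.congr (ae_of_all _ fun x => ?_))
    simp only [← Real.exp_add]
    ring_nf
  have hexp : ∀ x : Fin n → ℝ, Real.exp (x ⬝ᵥ v - v ⬝ᵥ v / 2) =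
      ∏ i, Real.exp (x i * v i - v i ^ 2 / 2) := fun x => by
    rw [← Real.exp_sum, Finset.sum_sub_distrib, ← Finset.sum_div]
    simp only [dotProduct, pow_two]
  simp_rw [hexp]
  rw [← ofReal_integral_eq_lintegral_ofReal (Integrable.fintype_prod hint)
      (ae_of_all _ fun x => Finset.prod_nonneg fun i _ => (Real.exp_pos _).le),
    integral_fintype_prod_eq_prod (f := fun i x => Real.exp (x * v i - v i ^ 2 / 2)),
    ENNReal.ofReal_prod_of_nonneg
      fun i _ => integral_nonneg fun x => (Real.exp_pos _).le]
  refine Finset.prod_congr rfl fun i _ => ?_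
  rw [gaussianReal_map_add_eq_withDensity, withDensity_apply _ (hs i),
    ofReal_integral_eq_lintegral_ofReal (hint i) (ae_of_all _ fun x => (Real.exp_pos _).le)]

lemma integral_exp_dotProduct_stdGaussianPi {n : ℕ} (w : Fin n → ℝ) :
    ∫ x, Real.exp (x ⬝ᵥ w) ∂(stdGaussianPi n) = Real.exp (w ⬝ᵥ w / 2) := by
  simp only [dotProduct, Real.exp_sum, Finset.sum_div]
  rw [stdGaussianPi, integral_fintype_prod_eq_prod (f := fun i x => Real.exp (x * w i))]
  refine Finset.prod_congr rfl fun i _ => ?_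
  have := congrFun (mgf_id_gaussianReal (μ := 0) (v := 1)) (w i)
  simp only [mgf, id] at this
  simp_rw [mul_comm _ (w i)]
  rw [this]
  congr 1
  simp
  ring

lemma integrable_exp_dotProduct_stdGaussianPi {n : ℕ} (w : Fin n → ℝ) :
    Integrable (fun x => Real.exp (x ⬝ᵥ w)) (stdGaussianPi n) := by
  -- A nonintegrable function has integral `0` by convention, while the value computed above is
  -- positive.
  by_contra h
  have := integral_exp_dotProduct_stdGaussianPi w
  rw [integral_undef h] at this
  exact (Real.exp_pos _).ne this

/-- Cauchy–Schwarz for `f` and the indicator of `s`: the quadratic `t ↦ ∫ (t 1_s - f)²` is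
nonnegative, so its discriminant is not positive. -/
lemma sq_setIntegral_le_measure_mul_integral_sq {Ω : Type*} [MeasurableSpace Ω] {μ : Measure Ω}
    [IsFiniteMeasure μ] {f : Ω → ℝ} {s : Set Ω} (hs : MeasurableSet s) (hf : Integrable f μ)
    (hf2 : Integrable (fun x => f x ^ 2) μ) :
    (∫ x in s, f x ∂μ) ^ 2 ≤ μ.real s * ∫ x, f x ^ 2 ∂μ := by
  have key : ∀ t : ℝ, 0 ≤ μ.real s * (t * t) + (-2 * ∫ x in s, f x ∂μ) * t + ∫ x, f x ^ 2 ∂μ := by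
    intro t
    have h1 : ∀ x, (t * s.indicator 1 x - f x) ^ 2 =
        t * t * s.indicator 1 x - 2 * t * s.indicator f x + f x ^ 2 := by
      intro x
      by_cases hx : x ∈ s
      · simp [hx]; ring
      · simp [hx]
    have h2 : 0 ≤ ∫ x, (t * s.indicator 1 x - f x) ^ 2 ∂μ := integral_nonneg fun x => sq_nonneg _
    have i1 : Integrable (fun x => t * t * s.indicator (1 : Ω → ℝ) x) μ :=
      ((integrable_const (1 : ℝ)).indicator hs).const_mul _
    have i2 : Integrable (fun x => 2 * t * s.indicator f x) μ := (hf.indicator hs).const_mul _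
    have i3 : Integrable
        (fun x => t * t * s.indicator (1 : Ω → ℝ) x - 2 * t * s.indicator f x) μ := i1.sub i2
    simp_rw [h1] at h2
    rw [integral_add i3 hf2, integral_sub i1 i2, integral_const_mul, integral_const_mul,
      integral_indicator_one hs, integral_indicator hs] at h2
    linarith
  have := discrim_le_zero key
  rw [discrim] at this
  nlinarith

/-- By `hinv` each shift may be replaced by its projection `w i`, whose Cameron–Martin density is `e
i`. Since `∫ e i * e j = exp (θ i ⬝ᵥ P *ᵥ θ j)`, the averaged density has `χ²` at most `X - 1`, and
Cauchy–Schwarz on `A` concludes. Keeping the measure of `A` under the root is what later yields the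
dependence on `δ`. -/
lemma sum_measure_add_shift_le {n : ℕ} {ι : Type*} (E : Finset ι) (θ : ι → Fin n → ℝ)
    {P : Matrix (Fin n) (Fin n) ℝ} (hsym : Pᵀ = P) (hidem : P * P = P)
    {A : Set (Fin n → ℝ)} (hA : MeasurableSet A)
    (hinv : ∀ i x, x + θ i ∈ A ↔ x + P *ᵥ θ i ∈ A) {X : ℝ}
    (hX : ∀ i ∈ E, ∑ j ∈ E, Real.exp (θ i ⬝ᵥ P *ᵥ θ j) ≤ X * E.card) :
    ∑ i ∈ E, (stdGaussianPi n).real {x | x + θ i ∈ A} ≤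
      E.card * ((stdGaussianPi n).real A + √((stdGaussianPi n).real A * (X - 1))) := by
  set γ := stdGaussianPi n
  set w : ι → Fin n → ℝ := fun i => P *ᵥ θ i with hw
  have hww : ∀ i j, w i ⬝ᵥ w j = θ i ⬝ᵥ P *ᵥ θ j := by
    intro i j
    simp only [hw]
    rw [dotProduct_mulVec, ← mulVec_transpose, hsym, mulVec_mulVec, hidem, dotProduct_comm,
      dotProduct_mulVec, ← mulVec_transpose, hsym, dotProduct_comm]
  let e : ι → (Fin n → ℝ) → ℝ := fun i x => Real.exp (x ⬝ᵥ w i - w i ⬝ᵥ w i / 2)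
  have he : ∀ i, Integrable (e i) γ := fun i => by
    refine ((integrable_exp_dotProduct_stdGaussianPi (w i)).mul_const
      (Real.exp (-(w i ⬝ᵥ w i / 2)))).congr (ae_of_all _ fun x => ?_)
    simp only [e, ← Real.exp_add]
    ring_nf
  have hmeas : ∀ i, γ.real {x | x + θ i ∈ A} = ∫ x in A, e i x ∂γ := by
    intro i
    have h1 : {x | x + θ i ∈ A} = (· + w i) ⁻¹' A := by
      ext x; exact hinv i x
    rw [h1, measureReal_def, ← Measure.map_apply (by fun_prop) hA,
      stdGaussianPi_map_add_eq_withDensity, withDensity_apply _ hA,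
      ← ofReal_integral_eq_lintegral_ofReal (he i).restrict
        (ae_of_all _ fun x => (Real.exp_pos _).le),
      ENNReal.toReal_ofReal (integral_nonneg fun x => (Real.exp_pos _).le)]
  have hprod : ∀ i j x, e i x * e j x =
      Real.exp (x ⬝ᵥ (w i + w j)) * Real.exp (-(w i ⬝ᵥ w i / 2) - (w j ⬝ᵥ w j / 2)) := by
    intro i j x
    simp only [e, ← Real.exp_add, dotProduct_add]
    ring_nf
  have hpi : ∀ i j, Integrable (fun x => e i x * e j x) γ := fun i j => by
    simp_rw [hprod]
    exact (integrable_exp_dotProduct_stdGaussianPi _).mul_const _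
  have hpv : ∀ i j, ∫ x, e i x * e j x ∂γ = Real.exp (w i ⬝ᵥ w j) := fun i j => by
    simp_rw [hprod]
    rw [integral_mul_const, integral_exp_dotProduct_stdGaussianPi, ← Real.exp_add]
    simp only [dotProduct_add, add_dotProduct, dotProduct_comm (w j) (w i)]
    ring_nf
  have hone : ∀ i, ∫ x, e i x ∂γ = 1 := fun i => by
    have : ∀ x, e i x = Real.exp (x ⬝ᵥ w i) * Real.exp (-(w i ⬝ᵥ w i / 2)) := fun x => by
      simp only [e, ← Real.exp_add]; ring_nf
    simp_rw [this]
    rw [integral_mul_const, integral_exp_dotProduct_stdGaussianPi, ← Real.exp_add]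
    simp
  set N : ℝ := (E.card : ℝ)
  let f : (Fin n → ℝ) → ℝ := fun x => ∑ i ∈ E, e i x - N
  have hsum : Integrable (fun x => ∑ i ∈ E, e i x) γ := integrable_finsetSum _ fun i _ => he i
  have hf : Integrable f γ := hsum.sub (integrable_const _)
  have hf2eq : ∀ x, f x ^ 2 =
      ∑ i ∈ E, ∑ j ∈ E, e i x * e j x - 2 * N * ∑ i ∈ E, e i x + N ^ 2 := fun x => by
    simp only [f]
    rw [← Finset.sum_mul_sum]; ring
  have hdd : Integrable (fun x => ∑ i ∈ E, ∑ j ∈ E, e i x * e j x) γ :=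
    integrable_finsetSum _ fun i _ => integrable_finsetSum _ fun j _ => hpi i j
  have hd2 : Integrable
      (fun x => ∑ i ∈ E, ∑ j ∈ E, e i x * e j x - 2 * N * ∑ i ∈ E, e i x) γ :=
    hdd.sub (hsum.const_mul _)
  have hf2 : Integrable (fun x => f x ^ 2) γ := by
    simp_rw [hf2eq]
    exact hd2.add (integrable_const _)
  have hf2v : ∫ x, f x ^ 2 ∂γ ≤ N ^ 2 * (X - 1) := by
    simp_rw [hf2eq]
    rw [integral_add hd2 (integrable_const _),
      integral_sub hdd (hsum.const_mul _), integral_const_mul,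
      integral_finsetSum _ fun i _ => integrable_finsetSum _ fun j _ => hpi i j,
      integral_finsetSum _ fun i _ => he i]
    have h1 : ∀ i ∈ E, ∫ x, ∑ j ∈ E, e i x * e j x ∂γ ≤ X * N := fun i hi => by
      rw [integral_finsetSum _ fun j _ => hpi i j]
      simp_rw [hpv, hww]
      exact hX i hi
    have h2 := Finset.sum_le_sum h1
    simp only [hone, Finset.sum_const, nsmul_eq_mul, integral_const, probReal_univ, smul_eq_mul]
      at h2 ⊢
    change _ ≤ N * (X * N) at h2
    change _ - 2 * N * (N * 1) + _ ≤ _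
    linarith
  have hAf : ∫ x in A, f x ∂γ =
      ∑ i ∈ E, γ.real {x | x + θ i ∈ A} - N * γ.real A := by
    simp only [f]
    rw [integral_sub hsum.restrict (integrable_const _),
      integral_finsetSum _ fun i _ => (he i).restrict]
    simp_rw [hmeas]
    simp [mul_comm]
  have hcs := sq_setIntegral_le_measure_mul_integral_sq hA hf hf2
  have hN : 0 ≤ N := Nat.cast_nonneg _
  have hs : 0 ≤ γ.real A := measureReal_nonneg
  have h3 : ∫ x in A, f x ∂γ ≤ √(γ.real A * (N ^ 2 * (X - 1))) := by
    apply Real.le_sqrt_of_sq_le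
    exact hcs.trans (mul_le_mul_of_nonneg_left hf2v hs)
  have h4 : √(γ.real A * (N ^ 2 * (X - 1))) = N * √(γ.real A * (X - 1)) := by
    rw [show γ.real A * (N ^ 2 * (X - 1)) = N ^ 2 * (γ.real A * (X - 1)) by ring,
      Real.sqrt_mul (sq_nonneg N), Real.sqrt_sq hN]
  rw [hAf, h4] at h3
  linarith

/-! ### From an approximating sketch to a two-hypothesis test -/

lemma measurable_freqMoment (p : ℝ) (n : ℕ) : Measurable (freqMoment p : (Fin n → ℝ) → ℝ) := by
  unfold freqMoment
  fun_prop

lemma LinearSketch.measurable_output {Ω : Type*} [MeasurableSpace Ω] {r n : ℕ}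
    (A : LinearSketch Ω r n) : Measurable fun q : Ω × (Fin n → ℝ) => A.output q.2 q.1 := by
  unfold LinearSketch.output
  have h := A.measurable_mat
  refine A.measurable_est.comp (measurable_fst.prodMk (measurable_pi_lambda _ fun i => ?_))
  change Measurable fun q : Ω × (Fin n → ℝ) => ∑ j, A.mat q.1 i j * q.2 j
  have h' : ∀ j, Measurable fun q : Ω × (Fin n → ℝ) => A.mat q.1 i j :=
    fun j => (h i j).comp measurable_fst
  fun_prop

/-- Averaging over the randomness of the sketch: some fixed outcome errs rarely on a given input
distribution. -/
lemma LinearSketch.exists_outcome_error_le {Ω : Type*} [MeasurableSpace Ω] {r n : ℕ}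
    {μ : Measure Ω} [IsProbabilityMeasure μ] {A : LinearSketch Ω r n} {p ε δ : ℝ}
    (h : A.Approximates μ p ε δ) (ν : Measure (Fin n → ℝ)) [IsFiniteMeasure ν] (hδ : 0 ≤ δ) :
    ∃ ω, ν.real {x | ¬ |A.output x ω - freqMoment p x| ≤ ε * freqMoment p x} ≤
      δ * ν.real Set.univ := by
  set B : Set (Ω × (Fin n → ℝ)) :=
    {q | ¬ |A.output q.2 q.1 - freqMoment p q.2| ≤ ε * freqMoment p q.2} with hB
  have hF : Measurable fun q : Ω × (Fin n → ℝ) => freqMoment p q.2 :=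
    (measurable_freqMoment p n).comp measurable_snd
  have hBm : MeasurableSet B :=
    (measurableSet_le (A.measurable_output.sub hF).abs (hF.const_mul ε)).compl
  have hx : ∀ x, μ ((fun ω => (ω, x)) ⁻¹' B) ≤ ENNReal.ofReal δ := by
    intro x
    have hm : MeasurableSet ((fun ω => (ω, x)) ⁻¹' B) := hBm.preimage (by fun_prop)
    have h1 := h x
    have h2 : {ω | |A.output x ω - freqMoment p x| ≤ ε * freqMoment p x} =
        ((fun ω => (ω, x)) ⁻¹' B)ᶜ := by
      ext ω; simp [hB]
    rw [h2, measureReal_compl hm, probReal_univ] at h1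
    rw [← ofReal_measureReal]
    exact ENNReal.ofReal_le_ofReal (by linarith)
  obtain ⟨ω, hω⟩ := exists_le_lintegral (μ := μ)
    (measurable_measure_prodMk_left (ν := ν) hBm).aemeasurable
  refine ⟨ω, ?_⟩
  rw [← Measure.prod_apply hBm, Measure.prod_apply_symm hBm] at hω
  have h3 := hω.trans (lintegral_mono hx)
  rw [lintegral_const] at h3
  have h4 := ENNReal.toReal_mono (by finiteness) h3
  rw [ENNReal.toReal_mul, ENNReal.toReal_ofReal hδ] at h4
  exact h4

/-- The two-hypothesis bound: pure Gaussian noise against Gaussian noise with a random shift. -/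
lemma LinearSketch.one_le_of_shifted_gaussian {Ω : Type*} [MeasurableSpace Ω] {r n : ℕ}
    {μ : Measure Ω} [IsProbabilityMeasure μ] {A : LinearSketch Ω r n} {p ε δ : ℝ}
    (h : A.Approximates μ p ε δ) (hδ : 0 ≤ δ) (hε : ε < 1)
    {ι : Type*} [Fintype ι] [Nonempty ι] (θ : ι → Fin n → ℝ) {U L e₁ e₂ B X : ℝ}
    (hUL : (1 + ε) * U < (1 - ε) * L) (hε0 : 0 ≤ ε)
    (he₁ : (stdGaussianPi n).real {x | ¬ freqMoment p x ≤ U} ≤ e₁)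
    (he₂ : ∀ i, (stdGaussianPi n).real {x | ¬ L ≤ freqMoment p (x + θ i)} ≤ e₂)
    (hB : 1 ≤ B) (hX1 : 1 ≤ X)
    (hE : ∀ P : Matrix (Fin n) (Fin n) ℝ, Pᵀ = P → P * P = P → P.trace ≤ r →
      ∃ E : Finset ι, E.Nonempty ∧ (Fintype.card ι : ℝ) ≤ B * E.card ∧
        ∀ i ∈ E, ∑ j ∈ E, Real.exp (θ i ⬝ᵥ P *ᵥ θ j) ≤ X * E.card) :
    1 ≤ B * (2 * δ + e₁ + e₂) + √((2 * δ + e₁ + e₂) * (X - 1)) := by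
  classical
  set γ := stdGaussianPi n with hγ
  set N : ℝ := (Fintype.card ι : ℝ) with hN
  have hNpos : 0 < N := by rw [hN]; exact_mod_cast Fintype.card_pos
  -- Both hypotheses are superposed without normalisation: `ν` has mass `2`, whence the term `2 *
  -- δ`.
  let ν : Measure (Fin n → ℝ) := γ + ENNReal.ofReal N⁻¹ • ∑ i, γ.map (· + θ i)
  have hνreal : ∀ s, MeasurableSet s →
      ν.real s = γ.real s + N⁻¹ * ∑ i, γ.real ((· + θ i) ⁻¹' s) := by
    intro s hs
    have hm : ∀ i, γ.map (· + θ i) s = γ ((· + θ i) ⁻¹' s) :=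
      fun i => Measure.map_apply (by fun_prop) hs
    simp only [ν, measureReal_def, Measure.add_apply, Measure.smul_apply, Measure.finsetSum_apply,
      hm, smul_eq_mul]
    rw [ENNReal.toReal_add (by finiteness) (ENNReal.mul_ne_top ENNReal.ofReal_ne_top
        (ENNReal.sum_ne_top.2 fun i _ => by finiteness)), ENNReal.toReal_mul,
      ENNReal.toReal_ofReal (inv_nonneg.2 hNpos.le), ENNReal.toReal_sum (by finiteness)]
  have : IsFiniteMeasure ν := by
    have : ∀ i, IsFiniteMeasure (γ.map (· + θ i)) := fun i => inferInstance
    refine ⟨?_⟩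
    simp only [ν, Measure.add_apply, Measure.smul_apply, Measure.finsetSum_apply, smul_eq_mul]
    exact ENNReal.add_lt_top.2 ⟨by finiteness, (ENNReal.mul_ne_top ENNReal.ofReal_ne_top
        (ENNReal.sum_ne_top.2 fun i _ => by finiteness)).lt_top⟩
  obtain ⟨ω, hω⟩ := LinearSketch.exists_outcome_error_le h ν hδ
  set bad : Set (Fin n → ℝ) := {x | ¬ |A.output x ω - freqMoment p x| ≤ ε * freqMoment p x}
    with hbad
  have hout : Measurable fun x => A.output x ω :=
    A.measurable_output.comp (measurable_const.prodMk measurable_id)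
  have hF := measurable_freqMoment p n
  have hbm : MeasurableSet bad :=
    (measurableSet_le (hout.sub hF).abs (hF.const_mul ε)).compl
  rw [hνreal _ hbm, hνreal _ MeasurableSet.univ] at hω
  simp only [Set.preimage_univ, probReal_univ, Finset.sum_const, Finset.card_univ, nsmul_eq_mul,
    mul_one] at hω
  rw [← hN, inv_mul_cancel₀ hNpos.ne'] at hω
  -- The test: a correct output exceeds `(1 + ε) * U` when `F_p ≥ L`, and does not when `F_p ≤ U`.
  set D : Set (Fin n → ℝ) := {x | (1 + ε) * U < A.output x ω} with hD
  have hDm : MeasurableSet D := measurableSet_lt measurable_const hout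
  obtain ⟨P, hsym, hidem, htr, hSP⟩ := exists_projection_of_matrix (A.mat ω)
  obtain ⟨E, hEne, hEc, hEX⟩ := hE P hsym hidem htr
  have hinv : ∀ i x, x + θ i ∈ D ↔ x + P *ᵥ θ i ∈ D := by
    intro i x
    have : A.output (x + θ i) ω = A.output (x + P *ᵥ θ i) ω := by
      simp only [LinearSketch.output, mulVec_add, mulVec_mulVec, hSP]
    simp only [hD, Set.mem_ofPred_eq, this]
  have hmain := sum_measure_add_shift_le E θ hsym hidem hDm hinv hEX
  have hs : γ.real D ≤ γ.real bad + e₁ := by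
    refine (measureReal_mono (fun x hx => ?_)).trans ((measureReal_union_le _ _).trans
      (add_le_add_right he₁ _))
    by_contra hc
    simp only [hbad, Set.mem_union, Set.mem_ofPred_eq, not_or, not_not] at hc
    have h1 := (abs_le.1 hc.1).2
    have : (1 + ε) * U < A.output x ω := hx
    nlinarith [hc.2]
  have ht : ∀ i, 1 - γ.real {x | x + θ i ∈ D} ≤ γ.real ((· + θ i) ⁻¹' bad) + e₂ := by
    intro i
    have hm : MeasurableSet {x | x + θ i ∈ D} := hDm.preimage (by fun_prop : Measurable (· + θ i))
    rw [← probReal_univ (μ := γ), ← measureReal_compl hm]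
    refine (measureReal_mono (fun x hx => ?_)).trans ((measureReal_union_le _ _).trans
      (add_le_add_right (he₂ i) _))
    by_contra hc
    simp only [hbad, Set.mem_union, Set.mem_ofPred_eq, not_or, not_not, Set.mem_preimage] at hc
    have h1 := (abs_le.1 hc.1).1
    have : ¬ (1 + ε) * U < A.output (x + θ i) ω := hx
    nlinarith [hc.2]
  have hEpos : (0 : ℝ) < E.card := by exact_mod_cast hEne.card_pos
  set s := γ.real bad
  set t := ∑ i, γ.real ((· + θ i) ⁻¹' bad) with htdef
  have ht0 : ∑ i ∈ E, γ.real ((· + θ i) ⁻¹' bad) ≤ t :=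
    Finset.sum_le_sum_of_subset_of_nonneg (Finset.subset_univ _) fun _ _ _ => measureReal_nonneg
  have ht1 : E.card - ∑ i ∈ E, γ.real {x | x + θ i ∈ D} ≤ t + E.card * e₂ := by
    have := Finset.sum_le_sum fun i (_ : i ∈ E) => ht i
    simp only [Finset.sum_sub_distrib, Finset.sum_add_distrib, Finset.sum_const, nsmul_eq_mul,
      mul_one] at this
    linarith
  -- Averaging the error over `E` instead of over all shifts costs at most the factor `B`.
  have ht2 : t ≤ B * E.card * (N⁻¹ * t) := by
    have h0 : 0 ≤ N⁻¹ * t :=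
      mul_nonneg (inv_nonneg.2 hNpos.le) (Finset.sum_nonneg fun _ _ => measureReal_nonneg)
    calc t = N * (N⁻¹ * t) := by field_simp
      _ ≤ _ := mul_le_mul_of_nonneg_right hEc h0
  have hs0 : 0 ≤ s := measureReal_nonneg
  have he₁0 : 0 ≤ e₁ := measureReal_nonneg.trans he₁
  have he₂0 : 0 ≤ e₂ := measureReal_nonneg.trans (he₂ (Classical.arbitrary ι))
  have ht3 : 0 ≤ N⁻¹ * t :=
    mul_nonneg (inv_nonneg.2 hNpos.le) (Finset.sum_nonneg fun _ _ => measureReal_nonneg)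
  have hsq : √(γ.real D * (X - 1)) ≤ √((2 * δ + e₁ + e₂) * (X - 1)) := by
    apply Real.sqrt_le_sqrt
    apply mul_le_mul_of_nonneg_right _ (by linarith)
    linarith
  have hfin : (E.card : ℝ) * 1 ≤ E.card * (B * (2 * δ + e₁ + e₂) +
      √((2 * δ + e₁ + e₂) * (X - 1))) := by
    have a1 : γ.real D ≤ B * (s + e₁) := by nlinarith
    have a2 : e₂ ≤ B * e₂ := by nlinarith
    have a3 : B * (s + N⁻¹ * t) ≤ B * (2 * δ) :=
      mul_le_mul_of_nonneg_left (by linarith) (by linarith)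
    have a4 : E.card * (γ.real D + e₂ + B * (N⁻¹ * t) + √(γ.real D * (X - 1))) ≤
        E.card * (B * (2 * δ + e₁ + e₂) + √((2 * δ + e₁ + e₂) * (X - 1))) :=
      mul_le_mul_of_nonneg_left (by linarith) hEpos.le
    linarith
  exact le_of_mul_le_mul_left hfin hEpos

/-! ### Sparse shifts: correlations of random spikes under a projection -/

lemma exp_sub_one_le_mul_exp (x : ℝ) : Real.exp x - 1 ≤ x * Real.exp x := by
  have h1 := Real.add_one_le_exp (-x)
  have h2 : Real.exp (-x) * Real.exp x = 1 := by rw [← Real.exp_add]; simp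
  nlinarith [Real.exp_pos x]

/-- The sum of spikes of height `a` at the positions `i 0, …, i (T - 1)`. -/
def spikeShift {n T : ℕ} (a : ℝ) (i : Fin T → Fin n) : Fin n → ℝ :=
  ∑ k, Pi.single (i k) a

lemma spikeShift_dotProduct_mulVec {n T : ℕ} (a : ℝ) (i j : Fin T → Fin n)
    (P : Matrix (Fin n) (Fin n) ℝ) :
    spikeShift a i ⬝ᵥ P *ᵥ spikeShift a j = ∑ k, a ^ 2 * ∑ l, P (i l) (j k) := by
  simp only [spikeShift, mulVec_sum, dotProduct_sum, sum_dotProduct]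
  refine Finset.sum_congr rfl fun k _ => ?_
  rw [Finset.mul_sum]
  refine Finset.sum_congr rfl fun l _ => ?_
  simp
  ring

section Projection

variable {n : ℕ} {P : Matrix (Fin n) (Fin n) ℝ}

lemma projection_apply_eq_sum (hsym : Pᵀ = P) (hidem : P * P = P) (u v : Fin n) :
    ∑ w, P w u * P w v = P u v := by
  conv_rhs => rw [← hidem, Matrix.mul_apply]
  refine Finset.sum_congr rfl fun w _ => ?_
  rw [← transpose_apply P u w, hsym]

lemma projection_diag_eq_sum_sq (hsym : Pᵀ = P) (hidem : P * P = P) (v : Fin n) :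
    ∑ w, P w v ^ 2 = P v v := by
  simp_rw [pow_two]
  exact projection_apply_eq_sum hsym hidem v v

lemma projection_diag_nonneg (hsym : Pᵀ = P) (hidem : P * P = P) (v : Fin n) : 0 ≤ P v v := by
  rw [← projection_diag_eq_sum_sq hsym hidem v]
  positivity

/-- `P` is the Gram matrix of its own columns, so this is Cauchy–Schwarz for two columns. -/
lemma abs_projection_apply_le (hsym : Pᵀ = P) (hidem : P * P = P) {u v : Fin n} {M : ℝ}
    (hu : P u u ≤ M) (hv : P v v ≤ M) : |P u v| ≤ M := by
  have h := Finset.sum_mul_sq_le_sq_mul_sq Finset.univ (fun w => P w u) (fun w => P w v)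
  rw [projection_apply_eq_sum hsym hidem, projection_diag_eq_sum_sq hsym hidem,
    projection_diag_eq_sum_sq hsym hidem] at h
  have h0 := projection_diag_nonneg hsym hidem u
  have h1 := projection_diag_nonneg hsym hidem v
  refine abs_le_of_sq_le_sq (h.trans ?_) (h0.trans hu)
  nlinarith

/-- Most tuples of positions have spike shifts whose projections are nearly uncorrelated with the
projection of an independent spike shift. -/
lemma exists_spike_positions (hsym : Pᵀ = P) (hidem : P * P = P) {T : ℕ} {a r τ : ℝ}
    (hn : 0 < n) (hT : 0 < T) (htr : P.trace ≤ r) (hr : 0 < r) (hτ : 0 < τ) (hτ1 : τ < 1)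
    (hρ : (1 + Real.exp (a ^ 2 * (r / (τ * n))) * a ^ 2 *
      √(r / (τ * n) / ((1 - τ) * n))) ^ T ≤ 1 + τ ^ 2) :
    ∃ E : Finset (Fin T → Fin n), E.Nonempty ∧
      (Fintype.card (Fin T → Fin n) : ℝ) ≤ ((1 - τ)⁻¹ ^ 2) ^ T * E.card ∧
      ∀ i ∈ E, ∑ j ∈ E, Real.exp (spikeShift a i ⬝ᵥ P *ᵥ spikeShift a j) ≤
        ((1 - τ)⁻¹ ^ 2) ^ T * E.card := by
  classical
  have hn' : (0 : ℝ) < n := by exact_mod_cast hn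
  have hτ' : 0 < 1 - τ := by linarith
  set M := r / (τ * n) with hM
  have hM0 : 0 < M := by positivity
  set ρ := Real.exp (a ^ 2 * M) * a ^ 2 * √(M / ((1 - τ) * n)) with hρdef
  have hρ0 : 0 ≤ ρ := by positivity
  -- By Markov's inequality for the diagonal, whose sum is at most `r`, all but `τ n` coordinates
  -- lie in `G`.
  set G : Finset (Fin n) := Finset.univ.filter fun v => P v v ≤ M with hG
  set g : ℝ := (G.card : ℝ) with hg
  have hGc : (1 - τ) * n ≤ g := by
    have h1 : ((Gᶜ).card : ℝ) * M ≤ r := by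
      rw [← nsmul_eq_mul, ← Finset.sum_const]
      calc ∑ v ∈ Gᶜ, M ≤ ∑ v ∈ Gᶜ, P v v := Finset.sum_le_sum fun v hv => by
            simp [hG] at hv; exact hv.le
        _ ≤ ∑ v, P v v := Finset.sum_le_sum_of_subset_of_nonneg (Finset.subset_univ _)
            fun v _ _ => projection_diag_nonneg hsym hidem v
        _ ≤ r := htr
    have h2 : ((Gᶜ).card : ℝ) ≤ τ * n := by
      have : r = (τ * n) * M := by rw [hM]; field_simp
      rw [this] at h1
      exact le_of_mul_le_mul_right h1 hM0
    have h3 : (G.card : ℝ) + (Gᶜ).card = n := by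
      exact_mod_cast (Finset.card_add_card_compl G).trans (Fintype.card_fin n)
    linarith
  have hg0 : 0 < g := lt_of_lt_of_le (by positivity) hGc
  -- On `G` entries are at most `M`, so the exponential is linearised at the cost `exp (a² M)`. The
  -- column has squared norm `P v v ≤ M`, which bounds the average of `|P u v|` by Cauchy–Schwarz.
  have hZ : ∀ v ∈ G, ∑ u ∈ G, Real.exp (a ^ 2 * |P u v|) ≤ g * (1 + ρ) := by
    intro v hv
    have hv' : P v v ≤ M := by simpa [hG] using hv
    have h1 : ∀ u ∈ G, Real.exp (a ^ 2 * |P u v|) ≤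
        1 + Real.exp (a ^ 2 * M) * a ^ 2 * |P u v| := by
      intro u hu
      have hu' : P u u ≤ M := by simpa [hG] using hu
      have h2 := abs_projection_apply_le hsym hidem hu' hv'
      set x := a ^ 2 * |P u v| with hx
      have h3 := exp_sub_one_le_mul_exp x
      have h5 : Real.exp x ≤ Real.exp (a ^ 2 * M) :=
        Real.exp_le_exp.2 (mul_le_mul_of_nonneg_left h2 (sq_nonneg _))
      have h6 : 0 ≤ x := by positivity
      have h7 := mul_le_mul_of_nonneg_left h5 h6
      calc Real.exp x ≤ 1 + x * Real.exp (a ^ 2 * M) := by linarith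
        _ = _ := by rw [hx]; ring
    have h2 : ∑ u ∈ G, |P u v| ≤ g * √(M / ((1 - τ) * n)) := by
      have h3 : (∑ u ∈ G, |P u v|) ^ 2 ≤ g * M := by
        have h4 := sq_sum_le_card_mul_sum_sq (s := G) (f := fun u => |P u v|)
        simp only [sq_abs] at h4
        refine h4.trans (mul_le_mul_of_nonneg_left ?_ hg0.le)
        refine le_trans ?_ hv'
        rw [← projection_diag_eq_sum_sq hsym hidem v]
        exact Finset.sum_le_sum_of_subset_of_nonneg (Finset.subset_univ _) fun _ _ _ => sq_nonneg _
      refine le_trans (Real.le_sqrt_of_sq_le h3) (Real.sqrt_le_iff.2 ⟨by positivity, ?_⟩)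
      rw [mul_pow, Real.sq_sqrt (by positivity)]
      calc g * M = g * ((1 - τ) * n) * (M / ((1 - τ) * n)) := by field_simp
        _ ≤ g ^ 2 * (M / ((1 - τ) * n)) := by
          rw [pow_two]
          gcongr
    calc _ ≤ ∑ u ∈ G, (1 + Real.exp (a ^ 2 * M) * a ^ 2 * |P u v|) := Finset.sum_le_sum h1
      _ = g + Real.exp (a ^ 2 * M) * a ^ 2 * ∑ u ∈ G, |P u v| := by
        rw [Finset.sum_add_distrib, ← Finset.mul_sum]; simp [hg]
      _ ≤ g + Real.exp (a ^ 2 * M) * a ^ 2 * (g * √(M / ((1 - τ) * n))) := by gcongr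
      _ = _ := by rw [hρdef]; ring
  -- For fixed `i` the positions `j k` vary independently, so the sum over all `j` in `GT` factors
  -- as `Y i ^ T`.
  let Y : (Fin T → Fin n) → ℝ := fun i => ∑ v ∈ G, Real.exp (a ^ 2 * ∑ l, |P (i l) v|)
  set GT : Finset (Fin T → Fin n) := Fintype.piFinset fun _ => G with hGT
  have hGTc : (GT.card : ℝ) = g ^ T := by simp [hGT, hg]
  have hYsum : ∑ i ∈ GT, Y i ≤ g * (g ^ T * (1 + τ ^ 2)) := by
    simp only [Y]
    rw [Finset.sum_comm]
    have h1 : ∀ v ∈ G, ∑ i ∈ GT, Real.exp (a ^ 2 * ∑ l, |P (i l) v|) ≤ g ^ T * (1 + τ ^ 2) := by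
      intro v hv
      simp_rw [Finset.mul_sum, Real.exp_sum]
      rw [hGT, Finset.sum_prod_piFinset (κ := Fin n) (ι := Fin T) G
        (fun _ u => Real.exp (a ^ 2 * |P u v|))]
      simp only [Finset.prod_const, Finset.card_univ, Fintype.card_fin]
      calc _ ≤ (g * (1 + ρ)) ^ T := by
            gcongr
            exact hZ v hv
        _ = g ^ T * (1 + ρ) ^ T := mul_pow _ _ _
        _ ≤ _ := by gcongr
    refine (Finset.sum_le_sum h1).trans ?_
    simp [hg]
  have hY1 : ∀ i, g ≤ Y i := by
    intro i
    simp only [Y, hg]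
    rw [Finset.card_eq_sum_ones]
    push_cast
    exact Finset.sum_le_sum fun v _ => Real.one_le_exp (by positivity)
  -- Markov's inequality for `Y i - g ≥ 0`, whose mean over `GT` is at most `g τ²`, discards at most
  -- a fraction `τ` of the tuples.
  set E := GT.filter fun i => Y i ≤ g * (1 + τ) with hE
  have hEc : (1 - τ) * g ^ T ≤ E.card := by
    set C := GT.filter fun i => ¬ Y i ≤ g * (1 + τ) with hC
    have h1 : (C.card : ℝ) * (g * τ) ≤ ∑ i ∈ GT, (Y i - g) := by
      rw [← nsmul_eq_mul, ← Finset.sum_const]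
      calc ∑ i ∈ C, g * τ ≤ ∑ i ∈ C, (Y i - g) := Finset.sum_le_sum fun i hi => by
            have := (Finset.mem_filter.1 hi).2
            linarith
        _ ≤ _ := Finset.sum_le_sum_of_subset_of_nonneg (Finset.filter_subset _ _)
            fun i _ _ => sub_nonneg.2 (hY1 i)
    rw [Finset.sum_sub_distrib, Finset.sum_const, nsmul_eq_mul, hGTc] at h1
    have h2 : (C.card : ℝ) ≤ τ * g ^ T := by
      have : (C.card : ℝ) * (g * τ) ≤ τ * g ^ T * (g * τ) := by linarith
      exact le_of_mul_le_mul_right this (by positivity)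
    have h3 : (E.card : ℝ) + C.card = g ^ T := by
      rw [← hGTc]
      exact_mod_cast Finset.card_filter_add_card_filter_not (s := GT) (fun i => Y i ≤ g * (1 + τ))
    linarith
  have hEpos : (0 : ℝ) < E.card := lt_of_lt_of_le (by positivity) hEc
  have hgE : g ^ T ≤ (1 - τ)⁻¹ ^ T * E.card := by
    have h1 : g ^ T ≤ (1 - τ)⁻¹ * E.card := by
      rw [inv_mul_eq_div, le_div_iff₀ hτ']; linarith
    refine h1.trans (mul_le_mul_of_nonneg_right ?_ hEpos.le)
    exact le_self_pow₀ ((one_le_inv₀ hτ').2 (by linarith)) hT.ne'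
  refine ⟨E, Finset.card_pos.1 (by exact_mod_cast hEpos), ?_, ?_⟩
  · have h1 : (n : ℝ) ≤ (1 - τ)⁻¹ * g := by
      rw [inv_mul_eq_div, le_div_iff₀ hτ']; linarith
    calc (Fintype.card (Fin T → Fin n) : ℝ) = (n : ℝ) ^ T := by simp
      _ ≤ ((1 - τ)⁻¹ * g) ^ T := by gcongr
      _ = (1 - τ)⁻¹ ^ T * g ^ T := mul_pow _ _ _
      _ ≤ (1 - τ)⁻¹ ^ T * ((1 - τ)⁻¹ ^ T * E.card) := by gcongr
      _ = _ := by ring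
  · intro i hi
    have hYi := (Finset.mem_filter.1 hi).2
    calc ∑ j ∈ E, Real.exp (spikeShift a i ⬝ᵥ P *ᵥ spikeShift a j)
        ≤ ∑ j ∈ E, ∏ k, Real.exp (a ^ 2 * ∑ l, |P (i l) (j k)|) := by
          refine Finset.sum_le_sum fun j _ => ?_
          rw [spikeShift_dotProduct_mulVec, Real.exp_sum]
          gcongr
          exact le_abs_self _
      _ ≤ ∑ j ∈ GT, ∏ k, Real.exp (a ^ 2 * ∑ l, |P (i l) (j k)|) :=
          Finset.sum_le_sum_of_subset_of_nonneg (Finset.filter_subset _ _)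
            fun _ _ _ => Finset.prod_nonneg fun _ _ => (Real.exp_pos _).le
      _ = Y i ^ T := by
          rw [hGT, Finset.sum_prod_piFinset (κ := Fin n) (ι := Fin T) G
            (fun _ v => Real.exp (a ^ 2 * ∑ l, |P (i l) v|))]
          simp [Y]
      _ ≤ (g * (1 + τ)) ^ T := by
          have := hg0.le.trans (hY1 i)
          gcongr
      _ ≤ (g * (1 - τ)⁻¹) ^ T := by
          have h1 : 1 + τ ≤ (1 - τ)⁻¹ := by
            rw [← one_div, le_div_iff₀ hτ']; nlinarith
          gcongr
      _ = (1 - τ)⁻¹ ^ T * g ^ T := by rw [mul_pow, mul_comm]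
      _ ≤ (1 - τ)⁻¹ ^ T * ((1 - τ)⁻¹ ^ T * E.card) := by gcongr
      _ = _ := by ring

end Projection

/-! ### Dense shifts: correlations of random sign vectors under a projection -/

/-- The vector with entries `±b` and the given signs. -/
def signShift {n : ℕ} (b : ℝ) (s : Fin n → Bool) : Fin n → ℝ :=
  fun v => b * if s v then 1 else -1

/-- For `u ≠ v`, flipping the sign at `u` pairs the terms into opposite ones. -/
lemma sum_sign_mul_sign {n : ℕ} (u v : Fin n) :
    ∑ s : Fin n → Bool, (signShift 1 s u * signShift 1 s v) = if u = v then 2 ^ n else 0 := by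
  classical
  split_ifs with h
  · subst h
    have : ∀ s : Fin n → Bool, signShift 1 s u * signShift 1 s u = 1 := fun s => by
      simp only [signShift]; split_ifs <;> norm_num
    simp [this]
  · refine Finset.sum_involution (fun s _ => Function.update s u (!s u)) (fun s _ => ?_)
      (fun s _ _ hs => ?_) (fun _ _ => Finset.mem_univ _) (fun s _ => ?_)
    · simp only [signShift, Function.update_self, Function.update_of_ne (Ne.symm h)]
      cases s u <;> cases s v <;> simp
    · have := congrFun hs u
      simp at this
    · simp

section Projection

variable {n : ℕ} {P : Matrix (Fin n) (Fin n) ℝ}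

lemma dotProduct_projection_mulVec_self (hsym : Pᵀ = P) (hidem : P * P = P) (x : Fin n → ℝ) :
    x ⬝ᵥ P *ᵥ x = ∑ v, (P *ᵥ x) v ^ 2 := by
  have : ∑ v, (P *ᵥ x) v ^ 2 = (P *ᵥ x) ⬝ᵥ (P *ᵥ x) := by simp [dotProduct, pow_two]
  rw [this, dotProduct_mulVec (P *ᵥ x), ← mulVec_transpose, hsym, mulVec_mulVec, hidem,
    dotProduct_comm]

/-- Most sign vectors have a small projection, hence are nearly uncorrelated with the projection of
an independent sign vector. -/
lemma exists_sign_vectors (hsym : Pᵀ = P) (hidem : P * P = P) {b r τ : ℝ}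
    (htr : P.trace ≤ r) (hr : 0 < r) (hτ : 0 < τ) (hτ1 : τ < 1) :
    ∃ E : Finset (Fin n → Bool), E.Nonempty ∧
      (Fintype.card (Fin n → Bool) : ℝ) ≤ (1 - τ)⁻¹ * E.card ∧
      ∀ i ∈ E, ∑ j ∈ E, Real.exp (signShift b i ⬝ᵥ P *ᵥ signShift b j) ≤
        (1 - τ)⁻¹ * Real.exp (b ^ 4 * r / (2 * τ)) * E.card := by
  classical
  have hτ' : 0 < 1 - τ := by linarith
  -- This is the squared length of the projected sign vector. Its mean is `P.trace`, since distinct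
  -- signs are uncorrelated, so Markov's inequality applies.
  let q : (Fin n → Bool) → ℝ := fun s => signShift 1 s ⬝ᵥ P *ᵥ signShift 1 s
  have hq0 : ∀ s, 0 ≤ q s := fun s => by
    simp only [q]
    rw [dotProduct_projection_mulVec_self hsym hidem]
    positivity
  have hqsum : ∑ s, q s ≤ 2 ^ n * r := by
    have h1 : ∀ s, q s = ∑ u, ∑ v, P u v * (signShift 1 s u * signShift 1 s v) := fun s => by
      simp only [q, dotProduct, mulVec, Finset.mul_sum]
      refine Finset.sum_congr rfl fun u _ => Finset.sum_congr rfl fun v _ => ?_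
      ring
    simp_rw [h1]
    rw [Finset.sum_comm]
    have h2 : ∀ u, ∑ s : Fin n → Bool, ∑ v, P u v * (signShift 1 s u * signShift 1 s v) =
        2 ^ n * P u u := fun u => by
      rw [Finset.sum_comm]
      simp_rw [← Finset.mul_sum, sum_sign_mul_sign]
      simp [mul_comm]
    simp_rw [h2, ← Finset.mul_sum]
    gcongr
    exact htr
  set E : Finset (Fin n → Bool) := Finset.univ.filter fun s => q s ≤ r / τ with hE
  have hEc : (1 - τ) * 2 ^ n ≤ E.card := by
    set C : Finset (Fin n → Bool) := Finset.univ.filter fun s => ¬ q s ≤ r / τ with hC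
    have h1 : (C.card : ℝ) * (r / τ) ≤ 2 ^ n * r := by
      rw [← nsmul_eq_mul, ← Finset.sum_const]
      calc ∑ i ∈ C, r / τ ≤ ∑ i ∈ C, q i := Finset.sum_le_sum fun i hi =>
            (not_le.1 (Finset.mem_filter.1 hi).2).le
        _ ≤ ∑ i, q i := Finset.sum_le_sum_of_subset_of_nonneg (Finset.subset_univ _)
            fun i _ _ => hq0 i
        _ ≤ _ := hqsum
    have h2 : (C.card : ℝ) ≤ τ * 2 ^ n := by
      have : (C.card : ℝ) * (r / τ) ≤ τ * 2 ^ n * (r / τ) := by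
        refine h1.trans_eq ?_
        field_simp
      exact le_of_mul_le_mul_right this (by positivity)
    have h3 : (E.card : ℝ) + C.card = 2 ^ n := by
      have := Finset.card_filter_add_card_filter_not (s := (Finset.univ : Finset (Fin n → Bool)))
        (fun s => q s ≤ r / τ)
      simp only [Finset.card_univ, Fintype.card_pi, Fintype.card_bool, Finset.prod_const,
        Fintype.card_fin] at this
      exact_mod_cast this
    linarith
  have hEpos : (0 : ℝ) < E.card := lt_of_lt_of_le (by positivity) hEc
  have h2n : (2 : ℝ) ^ n ≤ (1 - τ)⁻¹ * E.card := by
    rw [inv_mul_eq_div, le_div_iff₀ hτ']; linarith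
  refine ⟨E, Finset.card_pos.1 (by exact_mod_cast hEpos), by simpa using h2n, ?_⟩
  intro i hi
  have hqi : q i ≤ r / τ := (Finset.mem_filter.1 hi).2
  set c : Fin n → ℝ := P *ᵥ signShift 1 i with hc
  have hdot : ∀ j, signShift b i ⬝ᵥ P *ᵥ signShift b j =
      ∑ v, b ^ 2 * c v * (if j v then 1 else -1) := fun j => by
    have hb : ∀ s : Fin n → Bool, signShift b s = b • signShift 1 s := fun s => by
      ext v; simp [signShift]
    rw [hb i, hb j, mulVec_smul, dotProduct_smul, smul_dotProduct, dotProduct_mulVec,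
      ← mulVec_transpose, hsym, ← hc]
    simp only [dotProduct, signShift, smul_eq_mul, Finset.mul_sum]
    refine Finset.sum_congr rfl fun v _ => ?_
    ring
  calc ∑ j ∈ E, Real.exp (signShift b i ⬝ᵥ P *ᵥ signShift b j)
      ≤ ∑ j, Real.exp (signShift b i ⬝ᵥ P *ᵥ signShift b j) :=
        Finset.sum_le_sum_of_subset_of_nonneg (Finset.subset_univ _)
          fun _ _ _ => (Real.exp_pos _).le
    -- Independent signs make the sum factor coordinatewise; `cosh t ≤ exp (t² / 2)` then gives the
    -- sub-Gaussian bound.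
    _ = ∏ v, (2 * Real.cosh (b ^ 2 * c v)) := by
        simp_rw [hdot, Real.exp_sum]
        rw [← Fintype.piFinset_univ, Finset.sum_prod_piFinset (κ := Bool) (ι := Fin n) Finset.univ
          (fun v x => Real.exp (b ^ 2 * c v * if x then 1 else -1))]
        refine Finset.prod_congr rfl fun v _ => ?_
        simp only [Fintype.sum_bool, if_true, Bool.false_eq_true, if_false, mul_one, mul_neg,
          Real.cosh_eq]
        ring
    _ ≤ ∏ v, (2 * Real.exp ((b ^ 2 * c v) ^ 2 / 2)) := by
        have := fun v => (Real.cosh_pos (b ^ 2 * c v)).le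
        gcongr
        exact Real.cosh_le_exp_half_sq _
    _ = 2 ^ n * Real.exp (b ^ 4 / 2 * q i) := by
        rw [Finset.prod_mul_distrib, ← Real.exp_sum]
        simp only [Finset.prod_const, Finset.card_univ, Fintype.card_fin, q]
        rw [dotProduct_projection_mulVec_self hsym hidem, Finset.mul_sum]
        congr 2
        refine Finset.sum_congr rfl fun v _ => ?_
        ring
    _ ≤ (1 - τ)⁻¹ * E.card * Real.exp (b ^ 4 * r / (2 * τ)) := by
        gcongr
        calc b ^ 4 / 2 * q i ≤ b ^ 4 / 2 * (r / τ) := by gcongr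
          _ = _ := by field_simp
    _ = _ := by ring

end Projection

/-! ### Moments of shifted Gaussians and the bound of order `ε⁻²` -/

lemma freqMoment_nonneg (p : ℝ) {n : ℕ} (x : Fin n → ℝ) : 0 ≤ freqMoment p x :=
  Finset.sum_nonneg fun _ _ => Real.rpow_nonneg (abs_nonneg _) _

lemma LinearSketch.Approximates.mono {Ω : Type*} [MeasurableSpace Ω] {r n : ℕ}
    {μ : Measure Ω} [IsProbabilityMeasure μ] {A : LinearSketch Ω r n} {p ε δ ε' δ' : ℝ}
    (h : A.Approximates μ p ε δ) (hε : ε ≤ ε') (hδ : δ ≤ δ') : A.Approximates μ p ε' δ' := by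
  intro x
  refine le_trans (by linarith) ((h x).trans (measureReal_mono fun ω hω => ?_))
  exact le_trans (Set.mem_ofPred_eq ▸ hω :) (mul_le_mul_of_nonneg_right hε (freqMoment_nonneg p x))

/-- The absolute moment `E |g|^q` of a standard Gaussian. -/
noncomputable def gaussianAbsMoment (q : ℝ) : ℝ := ∫ x, |x| ^ q ∂(gaussianReal 0 1)

/-- The moment `E (|g| + 1)^q` of a standard Gaussian. -/
noncomputable def gaussianShiftedMoment (q : ℝ) : ℝ := ∫ x, (|x| + 1) ^ q ∂(gaussianReal 0 1)

lemma integrable_abs_add_one_rpow_gaussianReal {q : ℝ} (hq : 0 ≤ q) :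
    Integrable (fun x : ℝ => (|x| + 1) ^ q) (gaussianReal 0 1) := by
  have h1 : MemLp (fun x : ℝ => |x| + 1) (ENNReal.ofReal q) (gaussianReal 0 1) :=
    (memLp_id_gaussianReal' _ ENNReal.ofReal_ne_top).norm.add (memLp_const 1)
  have h2 := h1.integrable_norm_rpow'
  rw [ENNReal.toReal_ofReal hq] at h2
  refine h2.congr (ae_of_all _ fun x => ?_)
  have : (0 : ℝ) ≤ |x| + 1 := by positivity
  simp only [Real.norm_eq_abs, abs_of_nonneg this]

lemma abs_add_rpow_le {q b : ℝ} (hq : 0 ≤ q) (hb : |b| ≤ 1) (x : ℝ) :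
    |x + b| ^ q ≤ (|x| + 1) ^ q := by
  refine Real.rpow_le_rpow (abs_nonneg _) ((abs_add_le x b).trans ?_) hq
  linarith

lemma integrable_abs_add_rpow_gaussianReal {q b : ℝ} (hq : 0 ≤ q) (hb : |b| ≤ 1) :
    Integrable (fun x : ℝ => |x + b| ^ q) (gaussianReal 0 1) := by
  refine (integrable_abs_add_one_rpow_gaussianReal hq).mono' (by fun_prop)
    (ae_of_all _ fun x => ?_)
  rw [Real.norm_eq_abs, abs_of_nonneg (by positivity)]
  exact abs_add_rpow_le hq hb x

lemma integrable_abs_rpow_gaussianReal {q : ℝ} (hq : 0 ≤ q) :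
    Integrable (fun x : ℝ => |x| ^ q) (gaussianReal 0 1) := by
  simpa using integrable_abs_add_rpow_gaussianReal (b := 0) hq (by simp)

lemma gaussianAbsMoment_pos {q : ℝ} (hq : 0 ≤ q) : 0 < gaussianAbsMoment q := by
  rw [gaussianAbsMoment, integral_pos_iff_support_of_nonneg (fun x => by positivity)
    (integrable_abs_rpow_gaussianReal hq)]
  have : NullSingletonClass (gaussianReal 0 1) := nullSingletonClass_gaussianReal one_ne_zero
  have h1 : ({0}ᶜ : Set ℝ) ⊆ Function.support fun x : ℝ => |x| ^ q := fun x hx =>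
    (Real.rpow_pos_of_pos (abs_pos.2 hx) q).ne'
  refine lt_of_lt_of_le ?_ (measure_mono h1)
  rw [prob_compl_eq_one_sub (measurableSet_singleton 0)]
  simp

/-- Convexity of `t ↦ t ^ (p/2)` at the points `(x ± b)²`, whose midpoint is `x² + b²`; then one
factor `x² + b²` is split off and the rest is bounded below by `|x| ^ (p - 2)`. This is the
second-order gain that makes sign shifts visible in `F_p`. -/
lemma add_sq_mul_le_half_sum_rpow {p : ℝ} (hp : 2 < p) (x b : ℝ) :
    |x| ^ p + b ^ 2 * |x| ^ (p - 2) ≤ (|x + b| ^ p + |x - b| ^ p) / 2 := by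
  have hpow : ∀ y : ℝ, |y| ^ p = (y ^ 2) ^ (p / 2) := fun y => by
    rw [← sq_abs, ← Real.rpow_natCast, ← Real.rpow_mul (abs_nonneg _)]
    congr 1
    push_cast
    ring
  have hconv := (convexOn_rpow (p := p / 2) (by linarith)).2
    (Set.mem_Ici.2 (sq_nonneg (x + b))) (Set.mem_Ici.2 (sq_nonneg (x - b)))
    (show (0 : ℝ) ≤ 1 / 2 by norm_num) (show (0 : ℝ) ≤ 1 / 2 by norm_num) (by norm_num)
  simp only [smul_eq_mul] at hconv
  rw [show 1 / 2 * (x + b) ^ 2 + 1 / 2 * (x - b) ^ 2 = x ^ 2 + b ^ 2 by ring, ← hpow, ← hpow]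
    at hconv
  have h1 : |x| ^ p + b ^ 2 * |x| ^ (p - 2) ≤ (x ^ 2 + b ^ 2) ^ (p / 2) := by
    have h2 : |x| ^ (p - 2) = (x ^ 2) ^ (p / 2 - 1) := by
      rw [← sq_abs, ← Real.rpow_natCast, ← Real.rpow_mul (abs_nonneg _)]
      congr 1
      push_cast
      ring
    have h3 : |x| ^ p = x ^ 2 * |x| ^ (p - 2) := by
      rw [← sq_abs x, ← Real.rpow_natCast, ← Real.rpow_add' (abs_nonneg _)]
      · congr 1
        push_cast
        ring
      · push_cast
        linarith
    have h4 : (x ^ 2 + b ^ 2) ^ (p / 2) = (x ^ 2 + b ^ 2) * (x ^ 2 + b ^ 2) ^ (p / 2 - 1) := by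
      nth_rewrite 2 [← Real.rpow_one (x ^ 2 + b ^ 2)]
      rw [← Real.rpow_add' (by positivity)]
      · congr 1
        ring
      · linarith
    rw [h3, h4, ← add_mul, h2]
    refine mul_le_mul_of_nonneg_left (Real.rpow_le_rpow (sq_nonneg _) ?_ (by linarith))
      (by positivity)
    linarith [sq_nonneg b]
  linarith

lemma integral_abs_add_neg_rpow_gaussianReal (p b : ℝ) :
    ∫ x, |x + -b| ^ p ∂(gaussianReal 0 1) = ∫ x, |x + b| ^ p ∂(gaussianReal 0 1) := by
  have h : (gaussianReal 0 1).map (fun x => -x) = gaussianReal 0 1 := by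
    rw [gaussianReal_map_neg, neg_zero]
  conv_rhs => rw [← h]
  rw [integral_map (by fun_prop) (Measurable.aestronglyMeasurable (by fun_prop))]
  congr 1
  ext x
  rw [← abs_neg]
  congr 2
  ring

/-- By symmetry of the Gaussian, `b` and `-b` give the same mean, so the symmetrised pointwise
inequality suffices. -/
lemma moment_add_le_integral_abs_add_rpow {p b : ℝ} (hp : 2 < p) (hb : |b| ≤ 1) :
    gaussianAbsMoment p + b ^ 2 * gaussianAbsMoment (p - 2) ≤
      ∫ x, |x + b| ^ p ∂(gaussianReal 0 1) := by
  have i1 := integrable_abs_rpow_gaussianReal (q := p) (by linarith)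
  have i2 := integrable_abs_rpow_gaussianReal (q := p - 2) (by linarith)
  have i3 := integrable_abs_add_rpow_gaussianReal (q := p) (by linarith) hb
  have i4 := integrable_abs_add_rpow_gaussianReal (q := p) (b := -b) (by linarith) (by simpa)
  have h := integral_mono (i1.add (i2.const_mul (b ^ 2))) ((i3.add i4).div_const 2) fun x => by
    simpa [sub_eq_add_neg] using add_sq_mul_le_half_sum_rpow hp x b
  simp only [Pi.add_apply] at h
  rw [integral_add i1 (i2.const_mul _), integral_const_mul, integral_div, integral_add i3 i4,
    integral_abs_add_neg_rpow_gaussianReal] at h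
  rw [gaussianAbsMoment, gaussianAbsMoment]
  linarith

lemma memLp_two_abs_add_rpow_gaussianReal {p b : ℝ} (hp : 0 ≤ p) (hb : |b| ≤ 1) :
    MemLp (fun x : ℝ => |x + b| ^ p) 2 (gaussianReal 0 1) := by
  rw [memLp_two_iff_integrable_sq (by fun_prop)]
  refine (integrable_abs_add_rpow_gaussianReal (q := 2 * p) (by linarith) hb).congr
    (ae_of_all _ fun x => ?_)
  simp only
  rw [← Real.rpow_natCast, ← Real.rpow_mul (abs_nonneg _), mul_comm]
  norm_num

/-- Chebyshev's inequality for the frequency moment of a shifted Gaussian vector. -/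
lemma measure_freqMoment_add_sub_ge_le {p : ℝ} (hp : 0 ≤ p) {n : ℕ} (hn : 0 < n)
    {θ : Fin n → ℝ} (hθ : ∀ i, |θ i| ≤ 1) {ε : ℝ} (hε : 0 < ε) :
    (stdGaussianPi n).real {x | n * ε ≤ |freqMoment p (x + θ) -
      ∑ i, ∫ x, |x + θ i| ^ p ∂(gaussianReal 0 1)|} ≤
      gaussianShiftedMoment (2 * p) / (ε ^ 2 * n) := by
  have hn' : (0 : ℝ) < n := by exact_mod_cast hn
  have hm : ∀ i, MemLp (fun x : ℝ => |x + θ i| ^ p) 2 (gaussianReal 0 1) :=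
    fun i => memLp_two_abs_add_rpow_gaussianReal hp (hθ i)
  have hvar := variance_sum_pi (μ := fun _ : Fin n => gaussianReal 0 1) hm
  set F : (Fin n → ℝ) → ℝ := ∑ i, fun ω : Fin n → ℝ => |ω i + θ i| ^ p with hF
  have hFeq : ∀ x, F x = freqMoment p (x + θ) := fun x => by
    simp [hF, freqMoment, Finset.sum_apply]
  have hFL : MemLp F 2 (stdGaussianPi n) :=
    memLp_finsetSum' _ fun i _ => (hm i).comp_measurePreserving
      (measurePreserving_eval (fun _ : Fin n => gaussianReal 0 1) i)
  have hFint : ∫ x, F x ∂(stdGaussianPi n) = ∑ i, ∫ x, |x + θ i| ^ p ∂(gaussianReal 0 1) := by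
    simp only [hF, Finset.sum_apply]
    rw [stdGaussianPi, integral_finsetSum]
    · refine Finset.sum_congr rfl fun i _ => ?_
      exact integral_comp_eval (μ := fun _ : Fin n => gaussianReal 0 1) (i := i)
        (f := fun x : ℝ => |x + θ i| ^ p) (by fun_prop)
    · exact fun i _ => integrable_comp_eval (μ := fun _ : Fin n => gaussianReal 0 1) (i := i)
        (f := fun x : ℝ => |x + θ i| ^ p) ((hm i).integrable one_le_two)
  have hV : variance F (stdGaussianPi n) ≤ n * gaussianShiftedMoment (2 * p) := by
    rw [stdGaussianPi, hvar]
    refine (Finset.sum_le_card_nsmul _ _ (gaussianShiftedMoment (2 * p)) fun i _ => ?_).trans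
      (by simp)
    refine (variance_le_expectation_sq (hm i).1).trans ?_
    refine integral_mono_of_nonneg (ae_of_all _ fun x => sq_nonneg _)
      (integrable_abs_add_one_rpow_gaussianReal (by linarith)) (ae_of_all _ fun x => ?_)
    refine le_trans (le_of_eq ?_) (abs_add_rpow_le (q := 2 * p) (by linarith) (hθ i) x)
    simp only [Pi.pow_apply]
    rw [← Real.rpow_natCast, ← Real.rpow_mul (abs_nonneg _), mul_comm]
    norm_num
  have hc := meas_ge_le_variance_div_sq hFL (c := n * ε) (by positivity)
  rw [hFint] at hc
  simp_rw [hFeq] at hc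
  refine (ENNReal.toReal_mono ENNReal.ofReal_ne_top hc).trans ?_
  rw [ENNReal.toReal_ofReal (by have := variance_nonneg F (stdGaussianPi n); positivity)]
  calc variance F (stdGaussianPi n) / (n * ε) ^ 2
      ≤ n * gaussianShiftedMoment (2 * p) / (n * ε) ^ 2 := by gcongr
    _ = _ := by field_simp

-- At `θ = 0` the expression is `2 * δ₀ < 1`; continuity does the rest. A single `θ` will serve as
-- tail probability, Markov fraction and correlation exponent.
open Filter Topology in
lemma exists_small_slack {δ₀ : ℝ} (hδ₀ : δ₀ < 1 / 2) :
    ∃ θ : ℝ, 0 < θ ∧ θ < 1 ∧ (1 - θ)⁻¹ * (2 * δ₀ + θ + θ) +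
      √((2 * δ₀ + θ + θ) * ((1 - θ)⁻¹ * Real.exp θ - 1)) < 1 := by
  have hc : ContinuousAt (fun θ : ℝ => (1 - θ)⁻¹ * (2 * δ₀ + θ + θ) +
      √((2 * δ₀ + θ + θ) * ((1 - θ)⁻¹ * Real.exp θ - 1))) 0 := by
    have h1 : ContinuousAt (fun θ : ℝ => (1 - θ)⁻¹) 0 :=
      ContinuousAt.inv₀ (by fun_prop) (by norm_num)
    fun_prop
  have hv : (1 - (0 : ℝ))⁻¹ * (2 * δ₀ + 0 + 0) +
      √((2 * δ₀ + 0 + 0) * ((1 - 0)⁻¹ * Real.exp 0 - 1)) < 1 := by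
    norm_num
    linarith
  have h0 := hc.tendsto.eventually (gt_mem_nhds hv)
  have h1 : ∀ᶠ θ : ℝ in 𝓝 0, θ < 1 := gt_mem_nhds one_pos
  obtain ⟨θ, ⟨hθ, hθ1⟩, hθ0⟩ :=
    (((h0.and h1).filter_mono nhdsWithin_le_nhds).and self_mem_nhdsWithin :
      ∀ᶠ θ : ℝ in 𝓝[>] 0, _).exists
  exact ⟨θ, hθ0, hθ1, hθ⟩

/-- Lower bound of order `ε⁻²` for small `ε`. -/
lemma exists_sq_mul_rows_lower_bound {p : ℝ} (hp : 2 < p) {δ₀ : ℝ} (hδ0 : 0 < δ₀)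
    (hδ₀ : δ₀ < 1 / 2) :
    ∃ C κ ε₁ : ℝ, 0 < C ∧ 0 < κ ∧ 0 < ε₁ ∧ ∀ (n r : ℕ) (ε : ℝ), 0 < r → 0 < ε → ε ≤ ε₁ →
      C ≤ ε ^ 2 * n → ∀ (Ω : Type*) [MeasurableSpace Ω] (μ : Measure Ω) [IsProbabilityMeasure μ]
        (A : LinearSketch Ω r n), A.Approximates μ p ε δ₀ → κ ≤ ε ^ 2 * r := by
  obtain ⟨θ, hθ0, hθ1, hθ⟩ := exists_small_slack hδ₀
  set M := gaussianAbsMoment p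
  set M' := gaussianAbsMoment (p - 2)
  have hM : 0 < M := gaussianAbsMoment_pos (by linarith)
  have hM' : 0 < M' := gaussianAbsMoment_pos (by linarith)
  set V := gaussianShiftedMoment (2 * p)
  have hV : 0 ≤ V := integral_nonneg fun x => by positivity
  -- With `b² = K ε` the mean gain per coordinate is `(6 + 4 M) ε`, enough to beat two deviations
  -- `ε` and the factors `1 ± ε` when `ε ≤ 1/2`.
  set K := (6 + 4 * M) / M' with hK
  have hK0 : 0 < K := by positivity
  -- The first constant makes Chebyshev's bound at most `θ`, the second makes `b⁴ r / (2 θ) ≤ θ`,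
  -- and the third ensures `ε ≤ 1/2` and `b ≤ 1`.
  refine ⟨(V + 1) / θ, 2 * θ ^ 2 / K ^ 2, min (1 / 2) (1 / K), by positivity, by positivity,
    by positivity, ?_⟩
  intro n r ε hr hε hε₁ hC Ω _ μ _ A hA
  by_contra! hlt
  have hε2 : ε ≤ 1 / 2 := hε₁.trans (min_le_left _ _)
  have hεK : K * ε ≤ 1 := by
    have := hε₁.trans (min_le_right _ _)
    rwa [le_div_iff₀ hK0, mul_comm] at this
  have hn : 0 < n := by
    rcases Nat.eq_zero_or_pos n with h | h
    · subst h
      have : 0 < (V + 1) / θ := by positivity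
      simp at hC
      linarith
    · exact h
  have hn' : (0 : ℝ) < n := by exact_mod_cast hn
  have hr' : (0 : ℝ) < r := by exact_mod_cast hr
  set b := √(K * ε) with hb
  have hb2 : b ^ 2 = K * ε := Real.sq_sqrt (by positivity)
  have hb0 : 0 ≤ b := Real.sqrt_nonneg _
  have hb1 : b ≤ 1 := Real.sqrt_le_one.2 hεK
  have hVθ : V / (ε ^ 2 * n) ≤ θ := by
    rw [div_le_iff₀ (by positivity)]
    rw [div_le_iff₀ hθ0] at hC
    linarith
  have hs : ∀ (s : Fin n → Bool) i, |signShift b s i| = b := fun s i => by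
    simp only [signShift]
    split_ifs <;> simp [abs_of_nonneg hb0]
  have hs1 : ∀ (s : Fin n → Bool) i, |signShift b s i| ≤ 1 := fun s i => (hs s i).trans_le hb1
  have hs2 : ∀ (s : Fin n → Bool) i, signShift b s i ^ 2 = K * ε := fun s i => by
    rw [← sq_abs, hs, hb2]
  have hmain := LinearSketch.one_le_of_shifted_gaussian hA hδ0.le (by linarith)
    (ι := Fin n → Bool) (signShift b) (U := n * (M + ε)) (L := n * (M + K * ε * M' - ε))
    (e₁ := θ) (e₂ := θ) (B := (1 - θ)⁻¹) (X := (1 - θ)⁻¹ * Real.exp θ) ?_ hε.le ?_ ?_ ?_ ?_ ?_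
  · linarith
  · have : K * ε * M' = (6 + 4 * M) * ε := by rw [hK]; field_simp
    rw [this]
    have : 0 < n * ε * ((6 + 4 * M) * (1 - ε) - (2 + 2 * M)) := by
      have : 0 < (6 + 4 * M) * (1 - ε) - (2 + 2 * M) := by nlinarith
      positivity
    nlinarith
  · have h1 := measure_freqMoment_add_sub_ge_le (p := p) (by linarith) hn (θ := 0)
      (by simp) hε
    refine (measureReal_mono fun x hx => ?_).trans (h1.trans hVθ)
    simp only [Set.mem_ofPred_eq, add_zero, Pi.zero_apply] at hx ⊢
    rw [Finset.sum_const, Finset.card_univ, Fintype.card_fin, nsmul_eq_mul]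
    change _ ≤ |_ - n * M|
    refine le_trans ?_ (le_abs_self _)
    push Not at hx
    linarith
  · intro s
    have h1 := measure_freqMoment_add_sub_ge_le (p := p) (by linarith) hn (hs1 s) hε
    refine (measureReal_mono fun x hx => ?_).trans (h1.trans hVθ)
    simp only [Set.mem_ofPred_eq] at hx ⊢
    refine le_trans ?_ (neg_le_abs _)
    push Not at hx
    have h2 : n * (M + K * ε * M') ≤ ∑ i, ∫ x, |x + signShift b s i| ^ p ∂(gaussianReal 0 1) := by
      have := Finset.card_nsmul_le_sum Finset.univ
        (fun i => ∫ x, |x + signShift b s i| ^ p ∂(gaussianReal 0 1)) (M + K * ε * M')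
        fun i _ => by
          have := moment_add_le_integral_abs_add_rpow hp (hs1 s i)
          rwa [hs2] at this
      rwa [nsmul_eq_mul, Finset.card_univ, Fintype.card_fin] at this
    linarith
  · exact (one_le_inv₀ (by linarith)).2 (by linarith)
  · have h1 : 1 ≤ (1 - θ)⁻¹ := (one_le_inv₀ (by linarith)).2 (by linarith)
    have h2 : 1 ≤ Real.exp θ := Real.one_le_exp hθ0.le
    nlinarith
  · intro P hsym hidem htr
    obtain ⟨E, hE, hE1, hE2⟩ := exists_sign_vectors (b := b) hsym hidem htr hr' hθ0 hθ1
    refine ⟨E, hE, hE1, fun i hi => (hE2 i hi).trans ?_⟩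
    have h1 : b ^ 4 * r / (2 * θ) ≤ θ := by
      rw [div_le_iff₀ (by positivity), show b ^ 4 = (b ^ 2) ^ 2 by ring, hb2]
      rw [lt_div_iff₀ (by positivity)] at hlt
      nlinarith
    have h2 : 0 < 1 - θ := by linarith
    gcongr

/-! ### Exponential concentration of truncated noise and the effect of spikes -/

lemma gaussianReal_tail_le {R : ℝ} (hR : 0 ≤ R) :
    (gaussianReal 0 1).real {x | R < |x|} ≤ 2 * Real.exp (-(R ^ 2 / 2)) := by
  have h1 : (gaussianReal 0 1).real {x | R ≤ x} ≤ Real.exp (-(R ^ 2 / 2)) := by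
    have h := measure_ge_le_exp_mul_mgf (μ := gaussianReal 0 1) (X := id) R hR
      (by simpa using integrable_exp_mul_gaussianReal R)
    rw [mgf_id_gaussianReal, ← Real.exp_add] at h
    refine h.trans_eq ?_
    congr 1
    simp
    ring
  have h2 : (gaussianReal 0 1).real {x | R ≤ -x} = (gaussianReal 0 1).real {x | R ≤ x} := by
    have h : (gaussianReal 0 1).map (fun x => -x) = gaussianReal 0 1 := by
      rw [gaussianReal_map_neg, neg_zero]
    have hms : MeasurableSet {x : ℝ | R ≤ x} := measurableSet_Ici
    conv_rhs => rw [← h]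
    rw [map_measureReal_apply (by fun_prop) hms]
    rfl
  have h3 : {x : ℝ | R < |x|} ⊆ {x | R ≤ x} ∪ {x | R ≤ -x} := fun x hx => by
    rcases le_abs'.1 (le_of_lt (Set.mem_ofPred_eq ▸ hx :)) with h | h
    · right; simp only [Set.mem_ofPred_eq]; linarith
    · left; exact h
  refine (measureReal_mono h3).trans ((measureReal_union_le _ _).trans ?_)
  linarith

lemma stdGaussianPi_exists_abs_gt_le {n : ℕ} {R : ℝ} (hR : 0 ≤ R) :
    (stdGaussianPi n).real {x | ¬ ∀ i, |x i| ≤ R} ≤ n * (2 * Real.exp (-(R ^ 2 / 2))) := by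
  have h1 : {x : Fin n → ℝ | ¬ ∀ i, |x i| ≤ R} = ⋃ i, {x | R < |x i|} := by
    ext x; simp
  rw [h1]
  refine (measureReal_iUnion_fintype_le _).trans ?_
  refine (Finset.sum_le_card_nsmul _ _ (2 * Real.exp (-(R ^ 2 / 2))) fun i _ => ?_).trans (by simp)
  refine le_trans (le_of_eq ?_) (gaussianReal_tail_le hR)
  have hmp := measurePreserving_eval (fun _ : Fin n => gaussianReal 0 1) i
  rw [← hmp.map_eq, map_measureReal_apply (by fun_prop)
    (measurableSet_lt measurable_const (by fun_prop))]
  rfl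

/-- Hoeffding's inequality for a bounded function of the coordinates of a Gaussian vector. -/
lemma measure_sum_sub_integral_ge_le {n : ℕ} {f : ℝ → ℝ} (hf : Measurable f) {a b : ℝ}
    (hab : ∀ x, f x ∈ Set.Icc a b) {ε : ℝ} (hε : 0 ≤ ε) (hn : 0 < n) :
    (stdGaussianPi n).real {x | n * ε ≤ ∑ i, f (x i) - n * ∫ y, f y ∂(gaussianReal 0 1)} ≤
      Real.exp (-(2 * ε ^ 2 * n / (b - a) ^ 2)) := by
  have hn' : (n : ℝ) ≠ 0 := by exact_mod_cast hn.ne'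
  have hind : iIndepFun (fun (i : Fin n) (ω : Fin n → ℝ) =>
      f (ω i) - ∫ y, f y ∂(gaussianReal 0 1)) (stdGaussianPi n) :=
    iIndepFun_pi (μ := fun _ : Fin n => gaussianReal 0 1)
      (X := fun _ x => f x - ∫ y, f y ∂(gaussianReal 0 1)) fun i => by fun_prop
  have hsub : ∀ i ∈ (Finset.univ : Finset (Fin n)), HasSubgaussianMGF (fun ω : Fin n → ℝ =>
      f (ω i) - ∫ y, f y ∂(gaussianReal 0 1)) ((‖b - a‖₊ / 2) ^ 2) (stdGaussianPi n) := by
    intro i _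
    have h1 := hasSubgaussianMGF_of_mem_Icc (μ := stdGaussianPi n)
      (X := fun ω : Fin n → ℝ => f (ω i)) (a := a) (b := b)
      (hf.comp (measurable_pi_apply i)).aemeasurable (ae_of_all _ fun ω => hab (ω i))
    have h2 : ∫ ω : Fin n → ℝ, f (ω i) ∂(stdGaussianPi n) = ∫ y, f y ∂(gaussianReal 0 1) :=
      integral_comp_eval (μ := fun _ : Fin n => gaussianReal 0 1) (i := i) (f := f) (by fun_prop)
    rwa [h2] at h1
  have h := HasSubgaussianMGF.measure_sum_ge_le_of_iIndepFun hind hsub (ε := n * ε) (by positivity)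
  simp only [Finset.sum_sub_distrib, Finset.sum_const, Finset.card_univ, Fintype.card_fin,
    nsmul_eq_mul] at h
  refine h.trans_eq ?_
  congr 1
  simp only [NNReal.coe_mul, NNReal.coe_natCast, NNReal.coe_pow, NNReal.coe_div, coe_nnnorm,
    Real.norm_eq_abs, div_pow, sq_abs, NNReal.coe_ofNat]
  -- For `a = b` both exponents are quotients by zero, hence `0`.
  by_cases hba : b - a = 0
  · simp [hba]
  · field_simp

/-- The mean of `min |g| R ^ p` for a standard Gaussian `g`. -/
noncomputable def truncatedMoment (p R : ℝ) : ℝ := ∫ x, min |x| R ^ p ∂(gaussianReal 0 1)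

lemma truncatedMoment_le {p R : ℝ} (hp : 0 ≤ p) (hR : 0 ≤ R) :
    truncatedMoment p R ≤ gaussianAbsMoment p := by
  refine integral_mono_of_nonneg (ae_of_all _ fun x => ?_) (integrable_abs_rpow_gaussianReal hp)
    (ae_of_all _ fun x => ?_)
  · have : 0 ≤ min |x| R := le_min (abs_nonneg _) hR
    positivity
  · exact Real.rpow_le_rpow (le_min (abs_nonneg _) hR) (min_le_left _ _) hp

/-- The powers `|g| ^ p` with `p > 2` have no exponential moments, so Hoeffding is applied to `min
|x| R ^ p`, which agrees with `|x| ^ p` when all coordinates are at most `R`. Centring at the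
truncated mean avoids estimating the truncation bias. -/
lemma measure_not_concentrated_le {n : ℕ} (hn : 0 < n) {p R ε : ℝ} (hp : 0 ≤ p) (hR : 0 ≤ R)
    (hε : 0 ≤ ε) :
    (stdGaussianPi n).real {x | ¬ ((∀ i, |x i| ≤ R) ∧
      |freqMoment p x - n * truncatedMoment p R| < n * ε)} ≤
      n * (2 * Real.exp (-(R ^ 2 / 2))) + 2 * Real.exp (-(2 * ε ^ 2 * n / (R ^ p) ^ 2)) := by
  set f : ℝ → ℝ := fun x => min |x| R ^ p with hf
  have hfm : Measurable f := by fun_prop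
  have hfI : ∀ x, f x ∈ Set.Icc 0 (R ^ p) := fun x => by
    have : 0 ≤ min |x| R := le_min (abs_nonneg _) hR
    exact ⟨by positivity, Real.rpow_le_rpow this (min_le_right _ _) hp⟩
  have h1 := measure_sum_sub_integral_ge_le (n := n) hfm hfI hε hn
  have h2 := measure_sum_sub_integral_ge_le (n := n) (f := fun x => -f x) hfm.neg
    (a := -R ^ p) (b := 0) (fun x => ⟨neg_le_neg (hfI x).2, neg_nonpos.2 (hfI x).1⟩) hε hn
  simp only [sub_zero, zero_sub, neg_neg] at h1 h2
  have h3 := stdGaussianPi_exists_abs_gt_le (n := n) hR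
  refine (measureReal_mono (s₂ := {x | ¬ ∀ i, |x i| ≤ R} ∪ (
    {x | n * ε ≤ ∑ i, f (x i) - n * ∫ y, f y ∂(gaussianReal 0 1)} ∪
    {x | n * ε ≤ ∑ i, -f (x i) - n * ∫ y, -f y ∂(gaussianReal 0 1)})) fun x hx => ?_).trans
    ((measureReal_union_le _ _).trans ?_)
  · by_contra hc
    simp only [Set.mem_union, Set.mem_ofPred_eq, not_or, not_not, not_le] at hc
    refine hx ⟨hc.1, ?_⟩
    have hF : freqMoment p x = ∑ i, f (x i) := by
      simp only [freqMoment, hf]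
      exact Finset.sum_congr rfl fun i _ => by rw [min_eq_left (hc.1 i)]
    have h4 := hc.2.1
    have h5 := hc.2.2
    rw [integral_neg, Finset.sum_neg_distrib] at h5
    rw [hF, truncatedMoment, abs_lt]
    constructor <;> linarith
  · have := measureReal_union_le (μ := stdGaussianPi n)
      {x | n * ε ≤ ∑ i, f (x i) - n * ∫ y, f y ∂(gaussianReal 0 1)}
      {x | n * ε ≤ ∑ i, -f (x i) - n * ∫ y, -f y ∂(gaussianReal 0 1)}
    linarith

/-- Collisions do no harm: `m` spikes at one position give `|x + m a| ≥ m a / 2`, and `(m a / 2) ^ p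
≥ m (a / 2) ^ p` because `m ≥ 1` and `p ≥ 1`. -/
lemma freqMoment_add_spikeShift_ge {n T : ℕ} {p R a : ℝ} (hp : 1 ≤ p) (hR : 0 ≤ R)
    (ha : 2 * R ≤ a) (i : Fin T → Fin n) {x : Fin n → ℝ} (hx : ∀ v, |x v| ≤ R) :
    freqMoment p x + T * ((a / 2) ^ p - R ^ p) ≤ freqMoment p (x + spikeShift a i) := by
  classical
  let m : Fin n → ℕ := fun v => (Finset.univ.filter fun k => i k = v).card
  have hm : ∀ v, spikeShift a i v = m v * a := fun v => by
    simp only [spikeShift, Finset.sum_apply, Pi.single_apply, m]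
    rw [← Finset.sum_filter, Finset.sum_const, nsmul_eq_mul]
    simp only [eq_comm]
  have hmT : ∑ v, (m v : ℝ) = T := by
    have := Finset.card_eq_sum_card_fiberwise (s := (Finset.univ : Finset (Fin T)))
      (t := (Finset.univ : Finset (Fin n))) (f := i) (fun _ _ => by simp)
    simp only [Finset.card_univ, Fintype.card_fin] at this
    exact_mod_cast this.symm
  rw [← hmT, Finset.sum_mul, freqMoment, freqMoment, ← Finset.sum_add_distrib]
  refine Finset.sum_le_sum fun v _ => ?_
  rw [Pi.add_apply, hm v]
  rcases Nat.eq_zero_or_pos (m v) with h0 | hpos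
  · simp [h0]
  · have h1 : (1 : ℝ) ≤ m v := by exact_mod_cast hpos
    have ha0 : 0 ≤ a := by linarith
    have hxv := abs_le.1 (hx v)
    have h2 : m v * (a / 2) ≤ |x v + m v * a| := by
      refine le_trans ?_ (le_abs_self _)
      nlinarith
    have h3 : (m v * (a / 2)) ^ p ≤ |x v + m v * a| ^ p :=
      Real.rpow_le_rpow (by positivity) h2 (by linarith)
    rw [Real.mul_rpow (by positivity) (by positivity)] at h3
    have h4 : (m v : ℝ) ≤ (m v : ℝ) ^ p := by
      simpa using Real.rpow_le_rpow_of_exponent_le h1 hp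
    have h5 : |x v| ^ p ≤ R ^ p := Real.rpow_le_rpow (abs_nonneg _) (hx v) (by linarith)
    have h6 : 0 ≤ R ^ p := by positivity
    have h7 : 0 ≤ (a / 2) ^ p := by positivity
    nlinarith

/-- The constraint that a sketch of few rows would violate on sparse spikes in Gaussian noise. -/
lemma LinearSketch.one_le_of_spikes {Ω : Type*} [MeasurableSpace Ω] {r n : ℕ}
    {μ : Measure Ω} [IsProbabilityMeasure μ] {A : LinearSketch Ω r n} {p ε δ : ℝ}
    (h : A.Approximates μ p ε δ) (hδ : 0 ≤ δ) (hε0 : 0 < ε) (hε : ε < 1) (hp : 1 ≤ p)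
    (hn : 0 < n) (hr : 0 < r) {T : ℕ} (hT : 0 < T) {a R τ K e : ℝ} (hτ : 0 < τ) (hτ1 : τ < 1)
    (hR : 0 ≤ R) (ha : 2 * R ≤ a) (haK : T * (a / 2) ^ p = K * (ε * n))
    (hTR : T * R ^ p ≤ ε * n) (hK : 3 + 2 * gaussianAbsMoment p < (K - 2) * (1 - ε))
    (he : n * (2 * Real.exp (-(R ^ 2 / 2))) + 2 * Real.exp (-(2 * ε ^ 2 * n / (R ^ p) ^ 2)) ≤ e)
    (hρ : (1 + Real.exp (a ^ 2 * (r / (τ * n))) * a ^ 2 *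
      √(r / (τ * n) / ((1 - τ) * n))) ^ T ≤ 1 + τ ^ 2) :
    1 ≤ ((1 - τ)⁻¹ ^ 2) ^ T * (2 * δ + e + e) +
      √((2 * δ + e + e) * (((1 - τ)⁻¹ ^ 2) ^ T - 1)) := by
  have hn' : (0 : ℝ) < n := by exact_mod_cast hn
  have : Nonempty (Fin n) := ⟨⟨0, hn⟩⟩
  set m := truncatedMoment p R
  have hm : m ≤ gaussianAbsMoment p := truncatedMoment_le (by linarith) hR
  have hconc := (measure_not_concentrated_le hn (p := p) (by linarith) hR hε0.le).trans he
  have hB : 1 ≤ ((1 - τ)⁻¹ ^ 2) ^ T :=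
    one_le_pow₀ (one_le_pow₀ ((one_le_inv₀ (by linarith)).2 (by linarith)))
  -- The spikes contribute `K ε n`; truncation of the original entries (`hTR`) and the noise
  -- deviation each cost `ε n`, which leaves `K - 2`.
  refine LinearSketch.one_le_of_shifted_gaussian h hδ hε (ι := Fin T → Fin n) (spikeShift a)
    (U := n * (m + ε)) (L := n * (m + (K - 2) * ε)) ?_ hε0.le ?_ ?_ hB hB ?_
  · have h1 : 0 < n * ε * ((K - 2) * (1 - ε) - (1 + 2 * m + ε)) := by
      have : 0 < (K - 2) * (1 - ε) - (1 + 2 * m + ε) := by linarith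
      positivity
    nlinarith
  · refine (measureReal_mono fun x hx => ?_).trans hconc
    intro hc
    refine hx ?_
    have := (abs_lt.1 hc.2).2
    change freqMoment p x ≤ _
    linarith
  · intro i
    refine (measureReal_mono fun x hx => ?_).trans hconc
    intro hc
    refine hx ?_
    have h1 := (abs_lt.1 hc.2).1
    have h2 := freqMoment_add_spikeShift_ge hp hR ha i hc.1
    change _ ≤ freqMoment p (x + spikeShift a i)
    linarith
  · intro P hsym hidem htr
    exact exists_spike_positions hsym hidem hn hT htr (by exact_mod_cast hr) hτ hτ1 hρ

/-! ### At least one row is needed; asymptotic estimates for the parameters -/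

/-- Without rows the output ignores the input, yet the inputs `0` and a unit vector require outputs
in disjoint sets, each with probability above `1/2`. -/
lemma LinearSketch.Approximates.rows_pos {Ω : Type*} [MeasurableSpace Ω] {r n : ℕ}
    {μ : Measure Ω} [IsProbabilityMeasure μ] {A : LinearSketch Ω r n} {p ε δ : ℝ}
    (h : A.Approximates μ p ε δ) (hp : p ≠ 0) (hε : ε < 1) (hδ : δ < 1 / 2) (hn : 0 < n) :
    0 < r := by
  rcases Nat.eq_zero_or_pos r with h0 | h0
  · exfalso
    subst h0
    set x : Fin n → ℝ := Pi.single ⟨0, hn⟩ 1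
    have hout : ∀ ω, A.output x ω = A.output 0 ω := fun ω => by
      simp only [LinearSketch.output]
      exact congrArg _ (Subsingleton.elim _ _)
    have hF0 : freqMoment p (0 : Fin n → ℝ) = 0 := by
      simp [freqMoment, Real.zero_rpow hp]
    have hF1 : freqMoment p x = 1 := by
      rw [freqMoment, Finset.sum_eq_single ⟨0, hn⟩]
      · simp [x]
      · intro i _ hi
        simp [x, hi, Real.zero_rpow hp]
      · simp
    have h1 := h 0
    have h2 := h x
    simp only [hout, hF0, hF1] at h1 h2
    have hm : Measurable fun ω => A.output 0 ω :=
      A.measurable_output.comp (measurable_id.prodMk measurable_const)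
    have hms : MeasurableSet {ω | |A.output 0 ω - 1| ≤ ε * 1} :=
      measurableSet_le (hm.sub measurable_const).abs measurable_const
    have hd : Disjoint {ω | |A.output 0 ω - 0| ≤ ε * 0} {ω | |A.output 0 ω - 1| ≤ ε * 1} := by
      rw [Set.disjoint_left]
      intro ω h3 h4
      simp only [Set.mem_ofPred_eq] at h3 h4
      have h5 : A.output 0 ω = 0 := by simpa using h3
      rw [h5] at h4
      norm_num at h4
      linarith
    have h3 := measureReal_union (μ := μ) hd hms
    have h4 : μ.real ({ω | |A.output 0 ω - 0| ≤ ε * 0} ∪ {ω | |A.output 0 ω - 1| ≤ ε * 1}) ≤ 1 :=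
      measureReal_le_one
    linarith
  · exact h0

-- Allows each of `T` spikes to cost a factor `exp θ`: since `T ≤ 1 + log (1/δ)`, the total `exp (θ
-- T)` is at most `exp θ * δ ^ (-θ)`, absorbed by the factor `δ`. The limit at `θ = 0` is again `2 *
-- δ₀ < 1`.
open Filter Topology in
lemma exists_small_exponential_slack {δ₀ : ℝ} (hδ0 : 0 < δ₀) (hδ₀ : δ₀ < 1 / 2) :
    ∃ θ : ℝ, 0 < θ ∧ ∀ (δ : ℝ) (T : ℕ), 0 < δ → δ ≤ δ₀ → (T : ℝ) ≤ 1 + Real.log (1 / δ) →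
      Real.exp θ ^ T * (2 * δ + θ * δ + θ * δ) +
        √((2 * δ + θ * δ + θ * δ) * (Real.exp θ ^ T - 1)) < 1 := by
  have hc : ContinuousAt (fun θ : ℝ => (2 + 2 * θ) * (Real.exp θ * δ₀ ^ (1 - θ)) +
      √((2 + 2 * θ) * (2 * θ * Real.exp θ))) 0 := by
    have h1 : ContinuousAt (fun θ : ℝ => δ₀ ^ (1 - θ)) 0 :=
      ContinuousAt.rpow (by fun_prop) (by fun_prop) (Or.inl hδ0.ne')
    fun_prop
  have hv : (2 + 2 * (0 : ℝ)) * (Real.exp 0 * δ₀ ^ (1 - (0 : ℝ))) +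
      √((2 + 2 * 0) * (2 * 0 * Real.exp 0)) < 1 := by
    norm_num
    linarith
  have h0 := hc.tendsto.eventually (gt_mem_nhds hv)
  have h1 : ∀ᶠ θ : ℝ in 𝓝 0, θ < 1 / 2 := gt_mem_nhds (by norm_num)
  obtain ⟨θ, ⟨hθ, hθ1⟩, hθ0⟩ :=
    (((h0.and h1).filter_mono nhdsWithin_le_nhds).and self_mem_nhdsWithin :
      ∀ᶠ θ : ℝ in 𝓝[>] 0, _).exists
  have hθ0 : 0 < θ := hθ0
  refine ⟨θ, hθ0, fun δ T hδ hδδ hT => lt_of_le_of_lt ?_ hθ⟩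
  have hδ1 : δ ≤ 1 := by linarith
  have hpow : Real.exp θ ^ T = Real.exp (θ * T) := by rw [mul_comm, Real.exp_nat_mul]
  have hlog : Real.log (1 / δ) = -Real.log δ := by rw [one_div, Real.log_inv]
  have hexp : δ * Real.exp (θ * T) ≤ Real.exp θ * δ ^ (1 - θ) := by
    have : Real.exp θ * δ ^ (1 - θ) = δ * Real.exp (θ * (1 + Real.log (1 / δ))) := by
      rw [hlog, Real.rpow_def_of_pos hδ, ← Real.exp_add]
      nth_rewrite 2 [← Real.exp_log hδ]
      rw [← Real.exp_add]
      ring_nf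
    rw [this]
    gcongr
  have hmono : δ ^ (1 - θ) ≤ δ₀ ^ (1 - θ) := Real.rpow_le_rpow hδ.le hδδ (by linarith)
  have hA : δ * Real.exp (θ * T) ≤ Real.exp θ * δ₀ ^ (1 - θ) := hexp.trans (by gcongr)
  -- The extra factor `T` from `exp y - 1 ≤ y exp y` is absorbed by `√δ`, which is available since
  -- `1 - θ ≥ 1/2`.
  have hB : δ * (Real.exp (θ * T) - 1) ≤ 2 * θ * Real.exp θ := by
    have h2 : (1 + Real.log (1 / δ)) * δ ^ (1 / 2 : ℝ) ≤ 2 := by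
      have h3 := Real.log_le_sub_one_of_pos (Real.rpow_pos_of_pos hδ (-(1 / 2)))
      rw [Real.log_rpow hδ] at h3
      have h4 : 1 + Real.log (1 / δ) ≤ 2 * δ ^ (-(1 / 2) : ℝ) := by rw [hlog]; linarith
      refine (mul_le_mul_of_nonneg_right h4 (by positivity)).trans_eq ?_
      rw [mul_assoc, ← Real.rpow_add hδ]
      norm_num
    have h5 : δ ^ (1 - θ) ≤ δ ^ (1 / 2 : ℝ) :=
      Real.rpow_le_rpow_of_exponent_ge hδ hδ1 (by linarith)
    have hT0 : (0 : ℝ) ≤ T := Nat.cast_nonneg _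
    calc δ * (Real.exp (θ * T) - 1) ≤ δ * (θ * T * Real.exp (θ * T)) := by
          gcongr
          exact exp_sub_one_le_mul_exp _
      _ = θ * T * (δ * Real.exp (θ * T)) := by ring
      _ ≤ θ * T * (Real.exp θ * δ ^ (1 / 2 : ℝ)) := by
          exact mul_le_mul_of_nonneg_left (hexp.trans (by gcongr)) (by positivity)
      _ ≤ θ * (1 + Real.log (1 / δ)) * (Real.exp θ * δ ^ (1 / 2 : ℝ)) := by gcongr
      _ = θ * Real.exp θ * ((1 + Real.log (1 / δ)) * δ ^ (1 / 2 : ℝ)) := by ring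
      _ ≤ θ * Real.exp θ * 2 := by gcongr
      _ = _ := by ring
  rw [hpow]
  refine add_le_add ?_ (Real.sqrt_le_sqrt ?_)
  · calc Real.exp (θ * T) * (2 * δ + θ * δ + θ * δ) = (2 + 2 * θ) * (δ * Real.exp (θ * T)) := by
          ring
      _ ≤ _ := by gcongr
  · calc (2 * δ + θ * δ + θ * δ) * (Real.exp (θ * T) - 1)
        = (2 + 2 * θ) * (δ * (Real.exp (θ * T) - 1)) := by ring
      _ ≤ _ := by gcongr

/-- The correlation of two independent spike shifts is negligible when `a² r / n` is at most a small
multiple of `log n`. -/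
lemma correlation_pow_le {x a r τ ζ p A : ℝ} {T : ℕ} (hx : 1 ≤ x) (ha : 0 ≤ a) (hr : 0 ≤ r)
    (hτ : 0 < τ) (hτ1 : τ < 1) (hζ : 0 < ζ) (hζp : ζ = 1 / 2 - 1 / p) (hζ1 : ζ ≤ 1)
    (hA : 0 ≤ A) (haA : a ≤ A * x ^ (1 / p)) (hQ : a ^ 2 * r / x ≤ τ * (ζ / 4) * Real.log x)
    (hlog : Real.log x ≤ x ^ (ζ / 2)) (hT : (T : ℝ) ≤ 2 * x ^ (ζ / 4))
    (hsmall : 2 * (A / √(τ * (1 - τ))) * x ^ (-(ζ / 4)) ≤ Real.log (1 + τ ^ 2)) :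
    (1 + Real.exp (a ^ 2 * (r / (τ * x))) * a ^ 2 * √(r / (τ * x) / ((1 - τ) * x))) ^ T ≤
      1 + τ ^ 2 := by
  have hx0 : 0 < x := by linarith
  have hτ' : 0 < 1 - τ := by linarith
  have hlog0 : 0 ≤ Real.log x := Real.log_nonneg hx
  set ρ := Real.exp (a ^ 2 * (r / (τ * x))) * a ^ 2 * √(r / (τ * x) / ((1 - τ) * x)) with hρ
  -- This is the source of `log n` in the theorem: an exponent of size `(ζ/4) log x` costs only a
  -- small power of `x`.
  have h1 : Real.exp (a ^ 2 * (r / (τ * x))) ≤ x ^ (ζ / 4) := by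
    rw [Real.rpow_def_of_pos hx0]
    apply Real.exp_le_exp.2
    calc a ^ 2 * (r / (τ * x)) = a ^ 2 * r / x / τ := by field_simp
      _ ≤ τ * (ζ / 4) * Real.log x / τ := by gcongr
      _ = _ := by field_simp
  -- Up to constants the square is `a² (a² r / x) / x`, at most `x ^ (2/p + ζ/2 - 1) = x ^ (-3ζ/2)`.
  -- The gain is genuine because `ζ = 1/2 - 1/p > 0`.
  have h2 : a ^ 2 * √(r / (τ * x) / ((1 - τ) * x)) ≤
      A / √(τ * (1 - τ)) * x ^ (-(3 * ζ / 4)) := by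
    have hQ1 : a ^ 2 * r / x ≤ x ^ (ζ / 2) := by
      refine hQ.trans (le_trans ?_ hlog)
      have : τ * (ζ / 4) ≤ 1 := by nlinarith
      nlinarith
    have h3 : a ^ 2 * √(r / (τ * x) / ((1 - τ) * x)) =
        √(a ^ 2 * (a ^ 2 * r / x) / (τ * (1 - τ) * x)) := by
      rw [show a ^ 2 * (a ^ 2 * r / x) / (τ * (1 - τ) * x) =
        (a ^ 2) ^ 2 * (r / (τ * x) / ((1 - τ) * x)) by field_simp,
        Real.sqrt_mul (by positivity), Real.sqrt_sq (by positivity)]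
    rw [h3]
    apply Real.sqrt_le_iff.2 ⟨by positivity, ?_⟩
    have h4 : (A / √(τ * (1 - τ)) * x ^ (-(3 * ζ / 4))) ^ 2 =
        (A * x ^ (1 / p)) ^ 2 * x ^ (ζ / 2) / (τ * (1 - τ) * x) := by
      rw [mul_pow, div_pow, Real.sq_sqrt (by positivity), mul_pow]
      have h5 : (x ^ (-(3 * ζ / 4))) ^ 2 * x = (x ^ (1 / p)) ^ 2 * x ^ (ζ / 2) := by
        rw [← Real.rpow_natCast, ← Real.rpow_natCast, ← Real.rpow_mul hx0.le,
          ← Real.rpow_mul hx0.le, ← Real.rpow_add hx0, ← Real.rpow_add_one hx0.ne']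
        congr 1
        push_cast
        rw [hζp]
        ring
      rw [mul_assoc (A ^ 2), ← h5]
      field_simp
    rw [h4]
    gcongr
  have hρ0 : 0 ≤ ρ := by positivity
  have hρ1 : ρ ≤ A / √(τ * (1 - τ)) * x ^ (-(ζ / 2)) := by
    calc ρ = Real.exp (a ^ 2 * (r / (τ * x))) * (a ^ 2 * √(r / (τ * x) / ((1 - τ) * x))) := by
          rw [hρ]; ring
      _ ≤ x ^ (ζ / 4) * (A / √(τ * (1 - τ)) * x ^ (-(3 * ζ / 4))) := by gcongr
      _ = A / √(τ * (1 - τ)) * (x ^ (ζ / 4) * x ^ (-(3 * ζ / 4))) := by ring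
      _ = _ := by
        rw [← Real.rpow_add hx0]
        congr 2
        ring
  have h6 : (1 + ρ) ^ T ≤ Real.exp (T * ρ) := by
    rw [Real.exp_nat_mul]
    gcongr
    linarith [Real.add_one_le_exp ρ]
  refine h6.trans ?_
  rw [← Real.le_log_iff_exp_le (by positivity)]
  refine le_trans ?_ hsmall
  calc (T : ℝ) * ρ ≤ 2 * x ^ (ζ / 4) * (A / √(τ * (1 - τ)) * x ^ (-(ζ / 2))) := by gcongr
    _ = 2 * (A / √(τ * (1 - τ))) * (x ^ (ζ / 4) * x ^ (-(ζ / 2))) := by ring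
    _ = _ := by
      rw [← Real.rpow_add hx0]
      congr 2
      ring

/-- Both tails are at most `exp (-R² / 2) ≤ exp (-R)²`, as `R ≥ 4`. One factor `exp (-R)` absorbs
the union bound `2 x + 2`; the other is at most `δ`, because `log (1/δ) ≤ x ^ c ≤ R`. -/
lemma noise_tail_le {x p ε θ δ c R : ℝ} (hx : 1 ≤ x) (hp : 2 < p)
    (hc : c ≤ 1 / (8 * p ^ 2)) (hR : R = x ^ (1 / (8 * p ^ 2)))
    (hε : x ^ (-(1 / 2) + 1 / (4 * p)) ≤ ε) (hδ : (2 : ℝ) ^ (-(x ^ c)) ≤ δ) (hθ : 0 ≤ θ)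
    (h4 : 4 ≤ x ^ (1 / (8 * p ^ 2)))
    (hsmall : (2 * x + 2) * Real.exp (-(x ^ (1 / (8 * p ^ 2)))) ≤ θ) :
    x * (2 * Real.exp (-(R ^ 2 / 2))) + 2 * Real.exp (-(2 * ε ^ 2 * x / (R ^ p) ^ 2)) ≤
      θ * δ := by
  have hx0 : 0 < x := by linarith
  have hR0 : 0 < R := by rw [hR]; positivity
  rw [← hR] at h4 hsmall
  have h1 : R ^ 2 / 2 ≤ 2 * ε ^ 2 * x / (R ^ p) ^ 2 := by
    rw [le_div_iff₀ (by positivity)]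
    have h2 : (x ^ (-(1 / 2) + 1 / (4 * p))) ^ 2 * x ≤ ε ^ 2 * x := by gcongr
    have h3 : R ^ 2 * (R ^ p) ^ 2 ≤ (x ^ (-(1 / 2) + 1 / (4 * p))) ^ 2 * x := by
      have hsq : ∀ y : ℝ, (x ^ y) ^ 2 = x ^ (y * 2) := fun y => by
        rw [← Real.rpow_natCast, ← Real.rpow_mul hx0.le, Nat.cast_ofNat]
      rw [hR, ← Real.rpow_mul hx0.le, hsq, hsq, hsq, ← Real.rpow_add hx0,
        ← Real.rpow_add_one hx0.ne']
      apply Real.rpow_le_rpow_of_exponent_le hx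
      have : 1 / (8 * p ^ 2) * 2 + 1 / (8 * p ^ 2) * p * 2 = (1 + p) / (4 * p ^ 2) := by
        field_simp
        ring
      rw [this]
      have : (-(1 / 2) + 1 / (4 * p)) * 2 + 1 = (2 * p) / (4 * p ^ 2) := by
        field_simp
        ring
      rw [this]
      gcongr
      linarith
    nlinarith [sq_nonneg (ε), mul_nonneg (sq_nonneg ε) hx0.le]
  have h2 : Real.exp (-R) ≤ δ := by
    refine le_trans ?_ hδ
    rw [Real.rpow_def_of_pos two_pos]
    apply Real.exp_le_exp.2
    have h3 : x ^ c ≤ R := by rw [hR]; exact Real.rpow_le_rpow_of_exponent_le hx hc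
    have h5 : Real.log 2 ≤ 1 := by linarith [Real.log_two_lt_d9]
    have h6 : 0 < x ^ c := by positivity
    nlinarith [Real.log_pos one_lt_two]
  calc x * (2 * Real.exp (-(R ^ 2 / 2))) + 2 * Real.exp (-(2 * ε ^ 2 * x / (R ^ p) ^ 2))
      ≤ x * (2 * Real.exp (-(R ^ 2 / 2))) + 2 * Real.exp (-(R ^ 2 / 2)) := by gcongr
    _ = (2 * x + 2) * Real.exp (-(R ^ 2 / 2)) := by ring
    _ ≤ (2 * x + 2) * Real.exp (-R + -R) := by
        gcongr
        nlinarith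
    _ = (2 * x + 2) * Real.exp (-R) * Real.exp (-R) := by rw [Real.exp_add]; ring
    _ ≤ θ * δ := by gcongr

lemma eventually_log_le_rpow {s : ℝ} (hs : 0 < s) :
    ∀ᶠ x : ℝ in Filter.atTop, Real.log x ≤ x ^ s := by
  filter_upwards [(isLittleO_log_rpow_atTop hs).bound one_pos, Filter.eventually_ge_atTop 1]
    with x hx hx1
  rwa [one_mul, Real.norm_eq_abs, Real.norm_eq_abs, abs_of_nonneg (Real.log_nonneg hx1),
    abs_of_nonneg (by positivity)] at hx

lemma log_one_div_le_of_two_rpow_neg_le {y δ : ℝ} (hy : 0 ≤ y) (hδ : (2 : ℝ) ^ (-y) ≤ δ) :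
    Real.log (1 / δ) ≤ y := by
  have h1 := Real.log_le_log (by positivity) hδ
  rw [Real.log_rpow two_pos] at h1
  rw [one_div, Real.log_inv]
  have h2 : Real.log 2 ≤ 1 := by linarith [Real.log_two_lt_d9]
  nlinarith

/-- The signal-to-noise ratio of a single spike of the height that changes the frequency moment by
a factor `1 + O(ε)` when `T` of them are present. -/
lemma spike_energy_le {p x ε T l K r κ : ℝ} (hp : 0 < p) (hx : 1 ≤ x) (hε : 0 < ε) (hT : 0 < T)
    (hl : 0 ≤ l) (hlT : l ≤ T) (hK : 0 < K) (hκ : 0 ≤ κ)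
    (hr : r ≤ κ / (4 * K ^ (2 / p)) *
      (x ^ (1 - 2 / p) * ε ^ (-(2 / p)) * l ^ (2 / p) * Real.log x)) :
    (2 * (K * (ε * x) / T) ^ (1 / p)) ^ 2 * r / x ≤ κ * Real.log x := by
  have hx0 : 0 < x := by linarith
  have hlogx : 0 ≤ Real.log x := Real.log_nonneg hx
  have h1 : (2 * (K * (ε * x) / T) ^ (1 / p)) ^ 2 =
      4 * (K ^ (2 / p) * (ε ^ (2 / p) * x ^ (2 / p)) / T ^ (2 / p)) := by
    rw [mul_pow, ← Real.rpow_natCast ((K * (ε * x) / T) ^ (1 / p)),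
      ← Real.rpow_mul (by positivity), show 1 / p * ((2 : ℕ) : ℝ) = 2 / p by push_cast; ring,
      Real.div_rpow (by positivity) hT.le,
      Real.mul_rpow hK.le (by positivity), Real.mul_rpow hε.le hx0.le]
    norm_num
  have h2 : l ^ (2 / p) ≤ T ^ (2 / p) := Real.rpow_le_rpow hl hlT (by positivity)
  have h3 : r ≤ κ / (4 * K ^ (2 / p)) *
      (x ^ (1 - 2 / p) * ε ^ (-(2 / p)) * T ^ (2 / p) * Real.log x) := by
    refine hr.trans ?_
    gcongr
  rw [Real.rpow_sub hx0, Real.rpow_one, Real.rpow_neg hε.le] at h3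
  rw [div_le_iff₀ hx0, h1]
  refine (mul_le_mul_of_nonneg_left h3 (by positivity)).trans_eq ?_
  have e1 : 0 < K ^ (2 / p) := by positivity
  have e2 : 0 < ε ^ (2 / p) := by positivity
  have e3 : 0 < x ^ (2 / p) := by positivity
  have e4 : 0 < T ^ (2 / p) := by positivity
  generalize K ^ (2 / p) = u1 at e1 ⊢
  generalize ε ^ (2 / p) = u2 at e2 ⊢
  generalize x ^ (2 / p) = u3 at e3 ⊢
  generalize T ^ (2 / p) = u4 at e4 ⊢
  field_simp

lemma mul_truncation_rpow_le {p x ε T R : ℝ} (hp : 0 < p) (hx : 1 ≤ x)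
    (hT : T ≤ x ^ (1 / 4 : ℝ)) (hR : R = x ^ (1 / (8 * p ^ 2)))
    (hε : x ^ (-(1 / 2) + 1 / (4 * p)) ≤ ε) : T * R ^ p ≤ ε * x := by
  have hx0 : 0 < x := by linarith
  have h1 : R ^ p = x ^ (1 / (8 * p)) := by
    rw [hR, ← Real.rpow_mul hx0.le]
    congr 1
    field_simp
  rw [h1]
  calc T * x ^ (1 / (8 * p)) ≤ x ^ (1 / 4 : ℝ) * x ^ (1 / (8 * p)) := by gcongr
    _ = x ^ (1 / 4 + 1 / (8 * p)) := by rw [← Real.rpow_add hx0]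
    _ ≤ x ^ (-(1 / 2) + 1 / (4 * p) + 1) := by
        apply Real.rpow_le_rpow_of_exponent_le hx
        have h2 : 1 / (8 * p) ≤ 1 / (4 * p) := by
          apply one_div_le_one_div_of_le <;> linarith
        linarith
    _ = x ^ (-(1 / 2) + 1 / (4 * p)) * x := Real.rpow_add_one hx0.ne' _
    _ ≤ ε * x := by gcongr

lemma exists_forall_ge_estimates {p ζ θ τ : ℝ} (hp : 0 < p) (hζ0 : 0 < ζ) (hθ0 : 0 < θ)
    (hτ0 : 0 < τ) (B : ℝ) :
    ∃ N : ℕ, ∀ n ≥ N, Real.log n ≤ (n : ℝ) ^ (ζ / 2) ∧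
      2 * B * (n : ℝ) ^ (-(ζ / 4)) ≤ Real.log (1 + τ ^ 2) ∧ 2 ≤ (n : ℝ) ^ (1 / 8 : ℝ) ∧
      4 ≤ (n : ℝ) ^ (1 / (8 * p ^ 2)) ∧
      (2 * (n : ℝ) + 2) * Real.exp (-((n : ℝ) ^ (1 / (8 * p ^ 2)))) ≤ θ ∧ 1 ≤ (n : ℝ) := by
  have hs0 : 0 < 1 / (8 * p ^ 2) := by positivity
  have f1 := eventually_log_le_rpow (half_pos hζ0)
  have f2 : ∀ᶠ x : ℝ in Filter.atTop,
      2 * B * x ^ (-(ζ / 4)) ≤ Real.log (1 + τ ^ 2) := by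
    have h1 := (tendsto_rpow_neg_atTop (y := ζ / 4) (by positivity)).const_mul
      (2 * B)
    rw [mul_zero] at h1
    exact h1.eventually (ge_mem_nhds (Real.log_pos (by nlinarith)))
  have f3 : ∀ᶠ x : ℝ in Filter.atTop, 2 ≤ x ^ (1 / 8 : ℝ) :=
    (tendsto_rpow_atTop (by norm_num)).eventually_ge_atTop 2
  have f4 : ∀ᶠ x : ℝ in Filter.atTop, 4 ≤ x ^ (1 / (8 * p ^ 2)) :=
    (tendsto_rpow_atTop hs0).eventually_ge_atTop 4
  have f5 : ∀ᶠ x : ℝ in Filter.atTop,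
      (2 * x + 2) * Real.exp (-(x ^ (1 / (8 * p ^ 2)))) ≤ θ := by
    have h1 := ((tendsto_rpow_mul_exp_neg_mul_atTop_nhds_zero (8 * p ^ 2) 1 one_pos).comp
      (tendsto_rpow_atTop hs0)).const_mul 4
    rw [mul_zero] at h1
    filter_upwards [h1.eventually (ge_mem_nhds hθ0), Filter.eventually_ge_atTop 1] with x hx hx1
    refine le_trans ?_ hx
    simp only [Function.comp]
    rw [← Real.rpow_mul (by linarith), one_div_mul_cancel (by positivity), Real.rpow_one,
      neg_one_mul, ← mul_assoc]
    gcongr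
    linarith
  have fall := tendsto_natCast_atTop_atTop (R := ℝ) |>.eventually
    (f1.and (f2.and (f3.and (f4.and (f5.and (Filter.eventually_ge_atTop 1))))))
  exact Filter.eventually_atTop.1 fall

/-! ### The sparse regime and the assembly of the theorem -/

/-- The lower bound of the theorem when `ε` is well above `n ^ (-1/2)`. -/
lemma exists_sparse_rows_lower_bound {p : ℝ} (hp : 2 < p) {c ε₀ δ₀ : ℝ}
    (hc1 : c ≤ 1 / (8 * p ^ 2)) (hc2 : c ≤ (1 / 2 - 1 / p) / 4) (hε₀ : ε₀ < 1)
    (hδ0 : 0 < δ₀) (hδ₀ : δ₀ < 1 / 2) :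
    ∃ κ : ℝ, 0 < κ ∧ ∃ N : ℕ, ∀ (n r : ℕ) (ε δ : ℝ), N ≤ n → 0 < r →
      (n : ℝ) ^ (-(1 / 2) + 1 / (4 * p)) ≤ ε → ε ≤ ε₀ →
      (2 : ℝ) ^ (-((n : ℝ) ^ c)) ≤ δ → δ ≤ δ₀ →
      ∀ (Ω : Type*) [MeasurableSpace Ω] (μ : Measure Ω) [IsProbabilityMeasure μ]
        (A : LinearSketch Ω r n), A.Approximates μ p ε δ →
          κ * ((n : ℝ) ^ (1 - 2 / p) * ε ^ (-(2 / p)) * Real.log (1 / δ) ^ (2 / p)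
            * Real.log n) ≤ (r : ℝ) := by
  obtain ⟨θ, hθ0, hθ⟩ := exists_small_exponential_slack hδ0 hδ₀
  -- Chosen so that the cost per spike, `(1 - τ)⁻¹ ^ 2`, is exactly `exp θ`.
  set τ := 1 - Real.exp (-(θ / 2)) with hτdef
  have hτ0 : 0 < τ := by
    have : Real.exp (-(θ / 2)) < 1 := Real.exp_lt_one_iff.2 (by linarith)
    linarith
  have hτ1 : τ < 1 := by linarith [Real.exp_pos (-(θ / 2))]
  have hτθ : (1 - τ)⁻¹ ^ 2 = Real.exp θ := by
    rw [hτdef, sub_sub_cancel, ← Real.exp_neg, ← Real.exp_nat_mul]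
    congr 1
    push_cast
    ring
  set ζ := 1 / 2 - 1 / p with hζ
  have hp0 : 0 < p := by linarith
  have hζ0 : 0 < ζ := by
    have : 1 / p < 1 / 2 := one_div_lt_one_div_of_lt two_pos hp
    linarith
  have hζ1 : ζ ≤ 1 := by
    have : 0 < 1 / p := by positivity
    linarith
  set M := gaussianAbsMoment p
  have hM : 0 < M := gaussianAbsMoment_pos hp0.le
  have hε1 : 0 < 1 - ε₀ := by linarith
  -- Makes `(K - 2) (1 - ε₀) = 4 + 2 M`, just above the `3 + 2 M` needed to separate the hypotheses.
  set K := 2 + (4 + 2 * M) / (1 - ε₀) with hK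
  have hK0 : 0 < K := by positivity
  have hK1 : 1 ≤ K := by
    have : 0 < (4 + 2 * M) / (1 - ε₀) := by positivity
    linarith
  set Aa := 2 * K ^ (1 / p) with hAa
  have hAa0 : 0 ≤ Aa := by positivity
  obtain ⟨N, hN⟩ := exists_forall_ge_estimates hp0 hζ0 hθ0 hτ0 (Aa / √(τ * (1 - τ)))
  refine ⟨τ * (ζ / 4) / (4 * K ^ (2 / p)), by positivity, N, ?_⟩
  intro n r ε δ hn hr hεn hε hδn hδ Ω _ μ _ A hA
  obtain ⟨g1, g2, g3, g4, g5, hx1⟩ := hN n hn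
  have hn0 : 0 < n := by
    have : (0 : ℝ) < n := by linarith
    exact_mod_cast this
  set x : ℝ := (n : ℝ) with hx
  have hx0 : 0 < x := by linarith
  have hε0 : 0 < ε := lt_of_lt_of_le (by positivity) hεn
  have hδpos : 0 < δ := lt_of_lt_of_le (by positivity) hδn
  by_contra! hlt
  have hlog0 : 0 < Real.log (1 / δ) := Real.log_pos (by rw [lt_div_iff₀ hδpos]; linarith)
  set T : ℕ := ⌊Real.log (1 / δ)⌋₊ + 1 with hT
  have hT0 : 0 < T := Nat.succ_pos _
  have hTl : Real.log (1 / δ) ≤ T := by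
    rw [hT]; push_cast; exact (Nat.lt_floor_add_one _).le
  have hTu : (T : ℝ) ≤ 1 + Real.log (1 / δ) := by
    rw [hT]; push_cast; linarith [Nat.floor_le hlog0.le]
  have hT' : (0 : ℝ) < T := by exact_mod_cast hT0
  have hlogu : Real.log (1 / δ) ≤ x ^ c := log_one_div_le_of_two_rpow_neg_le (by positivity) hδn
  have hTz : (T : ℝ) ≤ 2 * x ^ (ζ / 4) := by
    have h1 : x ^ c ≤ x ^ (ζ / 4) := Real.rpow_le_rpow_of_exponent_le hx1 hc2
    have h2 : 1 ≤ x ^ (ζ / 4) := Real.one_le_rpow hx1 (by positivity)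
    linarith
  have hp2 : 1 / (8 * p ^ 2) ≤ 1 / 8 := by
    apply one_div_le_one_div_of_le (by norm_num)
    nlinarith
  have hT8 : (T : ℝ) ≤ x ^ (1 / 4 : ℝ) := by
    have h1 : x ^ c ≤ x ^ (1 / 8 : ℝ) :=
      Real.rpow_le_rpow_of_exponent_le hx1 (hc1.trans hp2)
    have h2 : x ^ (1 / 4 : ℝ) = x ^ (1 / 8 : ℝ) * x ^ (1 / 8 : ℝ) := by
      rw [← Real.rpow_add hx0]
      norm_num
    have h3 := mul_le_mul_of_nonneg_right g3 (show 0 ≤ x ^ (1 / 8 : ℝ) by positivity)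
    linarith
  set R := x ^ (1 / (8 * p ^ 2)) with hR
  have hR0 : 0 ≤ R := by positivity
  -- The height for which `T (a / 2) ^ p = K ε n`.
  set a := 2 * (K * (ε * x) / T) ^ (1 / p) with ha
  have ha0 : 0 ≤ a := by positivity
  have hTR : T * R ^ p ≤ ε * x := mul_truncation_rpow_le hp0 hx1 hT8 hR hεn
  have hapow : (a / 2) ^ p = K * (ε * x) / T := by
    rw [ha, mul_div_cancel_left₀ _ two_ne_zero, ← Real.rpow_mul (by positivity),
      one_div_mul_cancel hp0.ne', Real.rpow_one]
  have hRa : 2 * R ≤ a := by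
    have h1 : R ^ p ≤ (a / 2) ^ p := by
      rw [hapow, le_div_iff₀ hT']
      have := mul_le_mul_of_nonneg_right hK1 (mul_pos hε0 hx0).le
      linarith
    have h2 := (Real.rpow_le_rpow_iff hR0 (by positivity) hp0).1 h1
    linarith
  have haA : a ≤ Aa * x ^ (1 / p) := by
    rw [ha, hAa, mul_assoc, ← Real.mul_rpow hK0.le hx0.le]
    gcongr
    rw [div_le_iff₀ hT']
    have h1 : (1 : ℝ) ≤ T := by exact_mod_cast hT0
    calc K * (ε * x) ≤ K * (1 * x) := by gcongr; linarith
      _ = K * x * 1 := by ring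
      _ ≤ K * x * T := by gcongr
  have hQ : a ^ 2 * r / x ≤ τ * (ζ / 4) * Real.log x :=
    spike_energy_le hp0 hx1 hε0 hT' hlog0.le hTl hK0 (by positivity) hlt.le
  have hcorr := correlation_pow_le (T := T) hx1 ha0 (Nat.cast_nonneg r) hτ0 hτ1 hζ0 hζ hζ1 hAa0
    haA hQ g1 hTz g2
  have htail := noise_tail_le hx1 hp hc1 hR hεn hδn hθ0.le g4 g5
  have hKε : 3 + 2 * M < (K - 2) * (1 - ε) := by
    have h1 : (K - 2) * (1 - ε₀) = 4 + 2 * M := by rw [hK]; field_simp; ring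
    have h2 : (K - 2) * (1 - ε₀) ≤ (K - 2) * (1 - ε) := by
      have : 0 < (4 + 2 * M) / (1 - ε₀) := by positivity
      apply mul_le_mul_of_nonneg_left <;> linarith
    linarith
  have hone := LinearSketch.one_le_of_spikes hA hδpos.le hε0 (by linarith) (by linarith) hn0 hr hT0
    hτ0 hτ1 hR0 hRa (by rw [hapow]; field_simp; exact hx) hTR hKε htail hcorr
  rw [hτθ] at hone
  linarith [hθ δ T hδpos hδ hTu]

theorem mainTheorem3 (p : ℝ) (hp : 2 < p) :
    ∃ c : ℝ, 0 < c ∧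
      ∀ ε₀ δ₀ : ℝ, 0 < ε₀ → ε₀ < 1 → 0 < δ₀ → δ₀ < 1 / 2 →
        ∃ κ : ℝ, 0 < κ ∧
          ∀ (n r : ℕ) (ε δ : ℝ), 0 < ε → ε ≤ ε₀ →
            (2 : ℝ) ^ (-((n : ℝ) ^ c)) ≤ δ → δ ≤ δ₀ →
            ∀ (Ω : Type*) [MeasurableSpace Ω] (μ : Measure Ω) [IsProbabilityMeasure μ]
              (A : LinearSketch Ω r n), A.Approximates μ p ε δ →
                κ * min (n : ℝ)
                    ((n : ℝ) ^ (1 - 2 / p) * ε ^ (-(2 / p)) * Real.log (1 / δ) ^ (2 / p)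
                      * Real.log n)
                  ≤ (r : ℝ) := by
  have hp0 : 0 < p := by linarith
  have hζ0 : 0 < 1 / 2 - 1 / p := by
    have : 1 / p < 1 / 2 := one_div_lt_one_div_of_lt two_pos hp
    linarith
  -- The first bound keeps `log (1/δ)` below the truncation level `R`; the second keeps `T` at most
  -- `2 n ^ (ζ/4)`.
  set c := min (1 / (8 * p ^ 2)) ((1 / 2 - 1 / p) / 4) with hc
  have hc1 : c ≤ 1 / (8 * p ^ 2) := min_le_left _ _
  have hc2 : c ≤ (1 / 2 - 1 / p) / 4 := min_le_right _ _
  have hc0 : 0 < c := lt_min (by positivity) (by linarith)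
  refine ⟨c, hc0, ?_⟩
  intro ε₀ δ₀ hε₀0 hε₀ hδ₀0 hδ₀
  obtain ⟨κ₁, hκ₁, N₁, hsparse⟩ := exists_sparse_rows_lower_bound hp hc1 hc2 hε₀ hδ₀0 hδ₀
  obtain ⟨C, κ₂, ε₁, hC, hκ₂, hε₁, hdense⟩ := exists_sq_mul_rows_lower_bound hp hδ₀0 hδ₀
  have f1 : ∀ᶠ x : ℝ in Filter.atTop, √C * x ^ (-(1 / 2) : ℝ) ≤ ε₁ := by
    have h1 := (tendsto_rpow_neg_atTop (y := 1 / 2) (by positivity)).const_mul √C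
    rw [mul_zero] at h1
    exact h1.eventually (ge_mem_nhds hε₁)
  have f2 : ∀ᶠ x : ℝ in Filter.atTop, x ^ (-(1 / 2) + 1 / (4 * p)) ≤ ε₁ := by
    have h0 : 0 < 1 / 2 - 1 / (4 * p) := by
      have : 1 / (4 * p) < 1 / 2 := one_div_lt_one_div_of_lt two_pos (by linarith)
      linarith
    have h1 := tendsto_rpow_neg_atTop h0
    rw [show -(1 / 2 - 1 / (4 * p)) = -(1 / 2) + 1 / (4 * p) by ring] at h1
    exact h1.eventually (ge_mem_nhds hε₁)
  have f3 := eventually_log_le_rpow (s := 1 / (16 * p)) (by positivity)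
  have fall := tendsto_natCast_atTop_atTop (R := ℝ) |>.eventually
    (f1.and (f2.and (f3.and (Filter.eventually_ge_atTop 1))))
  obtain ⟨N₂, hN₂⟩ := Filter.eventually_atTop.1 fall
  set N : ℕ := max N₁ N₂ + 1 with hN
  have hN0 : (0 : ℝ) < N := by rw [hN]; positivity
  -- One constant per case: `ε` large, `n < N`, `ε < √(C/n)`, and `ε` in between.
  set κ := min (min κ₁ (1 / N)) (min (κ₂ / C) (κ₂ * C ^ (1 / p))) with hκ
  have hκ0 : 0 < κ := by rw [hκ]; positivity
  refine ⟨κ, hκ0, ?_⟩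
  intro n r ε δ hε hεε hδn hδ Ω _ μ _ A hA
  rcases Nat.eq_zero_or_pos n with hn0 | hn0
  · subst hn0
    have : min ((0 : ℕ) : ℝ) (((0 : ℕ) : ℝ) ^ (1 - 2 / p) * ε ^ (-(2 / p)) *
        Real.log (1 / δ) ^ (2 / p) * Real.log ((0 : ℕ) : ℝ)) ≤ 0 := by
      refine (min_le_left _ _).trans (by simp)
    exact (mul_nonpos_of_nonneg_of_nonpos hκ0.le this).trans (Nat.cast_nonneg r)
  have hr : 0 < r := hA.rows_pos hp0.ne' (by linarith) (by linarith) hn0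
  have hr1 : (1 : ℝ) ≤ r := by exact_mod_cast hr
  have hδpos : 0 < δ := lt_of_lt_of_le (by positivity) hδn
  have hlog0 : 0 < Real.log (1 / δ) := Real.log_pos (by rw [lt_div_iff₀ hδpos]; linarith)
  have hn1 : (1 : ℝ) ≤ n := by exact_mod_cast hn0
  have hlogn : 0 ≤ Real.log n := Real.log_nonneg hn1
  rcases lt_or_ge n N with hnN | hnN
  · calc κ * min (n : ℝ) _ ≤ 1 / N * n := by
          refine mul_le_mul ((min_le_left _ _).trans (min_le_right _ _)) (min_le_left _ _)
            (by positivity) (by positivity)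
      _ ≤ 1 / N * N := by gcongr
      _ = 1 := by field_simp
      _ ≤ r := hr1
  have hnN₁ : N₁ ≤ n := by omega
  have hnN₂ : N₂ ≤ n := by omega
  rcases le_or_gt ((n : ℝ) ^ (-(1 / 2) + 1 / (4 * p))) ε with hbig | hsmall
  · refine le_trans ?_ (hsparse n r ε δ hnN₁ hr hbig hεε hδn hδ Ω μ A hA)
    exact mul_le_mul ((min_le_left _ _).trans (min_le_left _ _)) (min_le_right _ _)
      (by positivity) hκ₁.le
  obtain ⟨g1, g2, g3, -⟩ := hN₂ n hnN₂
  set x : ℝ := (n : ℝ) with hx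
  have hx0 : 0 < x := by linarith
  have hsqrtx : (x ^ (-(1 / 2) : ℝ)) ^ 2 * x = 1 := by
    rw [← Real.rpow_natCast, ← Real.rpow_mul hx0.le, ← Real.rpow_add_one hx0.ne']
    norm_num
  -- Below `√(C/n)` the sketch is also valid for the weaker accuracy `√(C/n)`, which already forces
  -- `r` of order `n`.
  rcases lt_or_ge ε (√C * x ^ (-(1 / 2) : ℝ)) with hlow | hmid
  · set ε' := √C * x ^ (-(1 / 2) : ℝ) with hε'
    have h1 : ε' ^ 2 * x = C := by
      rw [hε', mul_pow, Real.sq_sqrt hC.le, mul_assoc, hsqrtx, mul_one]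
    have h2 := hdense n r ε' hr (hε.trans hlow) g1 h1.ge Ω μ A (hA.mono hlow.le hδ)
    have h3 : κ₂ * x ≤ C * r := by
      calc κ₂ * x ≤ ε' ^ 2 * r * x := by gcongr
        _ = ε' ^ 2 * x * r := by ring
        _ = C * r := by rw [h1]
    calc κ * min x _ ≤ κ₂ / C * x := by
          refine mul_le_mul ((min_le_right _ _).trans (min_le_left _ _)) (min_le_left _ _)
            (by positivity) (by positivity)
      _ = κ₂ * x / C := by ring
      _ ≤ r := by rw [div_le_iff₀ hC]; linarith
  · have h1 : C ≤ ε ^ 2 * x := by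
      calc C = (√C * x ^ (-(1 / 2) : ℝ)) ^ 2 * x := by
            rw [mul_pow, Real.sq_sqrt hC.le, mul_assoc, hsqrtx, mul_one]
        _ ≤ ε ^ 2 * x := by gcongr
    have h2 := hdense n r ε hr hε (hsmall.le.trans g2) h1 Ω μ A (hA.mono le_rfl hδ)
    -- Here `ε⁻²` exceeds `x ^ (1 - 1/(2p))`, while the target is at most of order `x ^ (1 -
    -- 7/(8p))`: `ε ^ (-2/p)` contributes order `x ^ (1/p)`, and each logarithmic factor at most `x
    -- ^ (1/(16p))`.
    have h3 : κ₂ * x ^ (1 - 1 / (2 * p)) ≤ r := by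
      have h4 : ε ^ 2 ≤ (x ^ (1 - 1 / (2 * p)))⁻¹ := by
        rw [← Real.rpow_neg hx0.le]
        calc ε ^ 2 ≤ (x ^ (-(1 / 2) + 1 / (4 * p))) ^ 2 := by gcongr
          _ = _ := by
            rw [← Real.rpow_natCast, ← Real.rpow_mul hx0.le]
            congr 1
            push_cast
            field_simp
            ring
      have h5 : κ₂ ≤ (x ^ (1 - 1 / (2 * p)))⁻¹ * r := h2.trans (by gcongr)
      rwa [inv_mul_eq_div, le_div_iff₀ (by positivity)] at h5
    refine le_trans ?_ h3
    have hlogu : Real.log (1 / δ) ≤ x ^ c := log_one_div_le_of_two_rpow_neg_le (by positivity) hδn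
    have hε2 : ε ^ (-(2 / p)) ≤ C ^ (-(1 / p)) * x ^ (1 / p) := by
      calc ε ^ (-(2 / p)) ≤ (√C * x ^ (-(1 / 2) : ℝ)) ^ (-(2 / p)) :=
            Real.rpow_le_rpow_of_nonpos (by positivity) hmid (by
              have : 0 < 2 / p := by positivity
              linarith)
        _ = _ := by
          rw [Real.mul_rpow (by positivity) (by positivity), Real.sqrt_eq_rpow,
            ← Real.rpow_mul hC.le, ← Real.rpow_mul hx0.le]
          congr 2 <;> ring
    have hlp : Real.log (1 / δ) ^ (2 / p) ≤ x ^ (1 / (16 * p)) := by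
      calc Real.log (1 / δ) ^ (2 / p) ≤ (x ^ c) ^ (2 / p) := by gcongr
        _ = x ^ (c * (2 / p)) := by rw [← Real.rpow_mul hx0.le]
        _ ≤ x ^ (1 / (16 * p)) := by
          apply Real.rpow_le_rpow_of_exponent_le hn1
          have hc32 : c ≤ 1 / 32 := by
            refine hc1.trans (one_div_le_one_div_of_le (by norm_num) ?_)
            nlinarith
          calc c * (2 / p) ≤ 1 / 32 * (2 / p) := by gcongr
            _ = 1 / (16 * p) := by field_simp; norm_num
    calc κ * min x _ ≤ κ₂ * C ^ (1 / p) * (x ^ (1 - 2 / p) * ε ^ (-(2 / p)) *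
          Real.log (1 / δ) ^ (2 / p) * Real.log x) := by
          refine mul_le_mul ((min_le_right _ _).trans (min_le_right _ _)) (min_le_right _ _)
            (by positivity) (by positivity)
      _ ≤ κ₂ * C ^ (1 / p) * (x ^ (1 - 2 / p) * (C ^ (-(1 / p)) * x ^ (1 / p)) *
          x ^ (1 / (16 * p)) * x ^ (1 / (16 * p))) := by gcongr
      _ = κ₂ * (C ^ (1 / p) * C ^ (-(1 / p))) *
          (x ^ (1 - 2 / p) * x ^ (1 / p) * x ^ (1 / (16 * p)) * x ^ (1 / (16 * p))) := by ring
      _ = κ₂ * x ^ (1 - 2 / p + 1 / p + 1 / (16 * p) + 1 / (16 * p)) := by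
          rw [← Real.rpow_add hC, ← Real.rpow_add hx0, ← Real.rpow_add hx0, ← Real.rpow_add hx0]
          simp
      _ ≤ κ₂ * x ^ (1 - 1 / (2 * p)) := by
          refine mul_le_mul_of_nonneg_left (Real.rpow_le_rpow_of_exponent_le hn1 ?_) hκ₂.le
          · have : 1 - 2 / p + 1 / p + 1 / (16 * p) + 1 / (16 * p) = 1 - 7 / 8 * (1 / p) := by
              field_simp
              ring
            rw [this, show 1 / (2 * p) = 1 / 2 * (1 / p) by field_simp]
            have : 0 < 1 / p := by positivity
            linarith
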